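/- Let $k$ be a field. Let $A=\bigoplus_{n\ge 0}A_n$ be a Koszul algebra over $k$, i.e. $A_0=k$, $\dim_k A_1<\infty$, $A=T(A_1)/\langle R_A\rangle$ with $R_A=\ker(A_1\otimes A_1\to A_2)$, and the trivial left module $k=A/A_{\ge 1}$ has a resolution by graded projective modules $P_n$ generated in degree $n$. Let $B=A_P[y_1,y_2;\sigma]$, $P=\{p,q\}\subset k$, be a graded trimmed right double Ore extension of $A$: $B$ is a graded $k$-algebra containing $A$ as a graded subalgebra, generated by $A$ and two elements $y_1,y_2\in B_1$, such that $y_2y_1=py_1y_2+qy_1^2$, $B$ is a free left $A$-module with basis $\{y_1^iy_2^j : i,j\ge 0\}$, and $y_ja=\sigma_{j1}(a)y_1+\sigma_{j2}(a)y_2$ for all $a\in A$, $j=1,2$, where $\sigma=(\sigma_{jl}):A\to M_{2\times 2}(A)$. Then $B_1=A_1\oplus ky_1\oplus ky_2$; let $A^!=T(A_1^*)/\langle R_A^\perp\rangle$ and $B^!=T(B_1^*)/\langle R_B^\perp\rangle$ with $R_B=\ker(B_1\otimes B_1\to B_2)$, let $y_1^*,y_2^*\in B_1^*$ be the forms that vanish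 on $A_1$ with $y_j^*(y_l)=\delta_{jl}$, and let $A^!\to B^!$ be the algebra homomorphism that extends a form on $A_1$ to $B_1$ by zero on $y_1$ and $y_2$. (1) The map $A^!\to B^!$ is injective. (2) If $p\neq 0$, then $B^!$ is a free right $A^!$-module with basis $\{1,y_1^*,y_2^*,y_1^*y_2^*\}$. (3) If $B$ is a double Ore extension of $A$, i.e. it is also a left double Ore extension with the same $y_1,y_2$ (it is generated by $A,y_1,y_2$; $y_1y_2=p'y_2y_1+q'y_1^2+\tau_1'y_1+\tau_2'y_2+\tau_0'$ for some $p',q'\in k$ and $\tau'_0,\tau_1',\tau_2'\in A$; $B$ is a free right $A$-module with basis $\{y_2^iy_1^j : i,j\ge 0\}$; and $Ay_1+Ay_2\subseteq y_1A+y_2A+A$), then $B^!$ is free both as a right and as a left $A^!$-module with basis $\{1,y_1^*,y_2^*,y_1^*y_2^*\}$; that is, $B^!=A^!\oplus A^!y_1^*\oplus A^!y_2^*\oplus A^!y_1^*y_2^*=A^!\oplus y_1^*A^!\oplus y_2^*A^!\oplus y_1^*y_2^*A^!$ with each summand free of rank one. -/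

import Mathlib

open scoped TensorProduct

universe u v w

namespace KoszulOre

section QuadraticAlgebras

variable {k : Type u} [Field k]

/-- The canonical map `V ⊗ V → A`, `x ⊗ y ↦ g x * g y`, attached to a linear map `g : V → A`. -/
noncomputable def mulTensor {V : Type v} [AddCommGroup V] [Module k V]
    {A : Type w} [Ring A] [Algebra k A] (g : V →ₗ[k] A) : V ⊗[k] V →ₗ[k] A :=
  (LinearMap.mul' k A).comp (TensorProduct.map g g)

theorem mulTensor_tmul {V : Type v} [AddCommGroup V] [Module k V]
    {A : Type w} [Ring A] [Algebra k A] (g : V →ₗ[k] A) (x y : V) :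
    mulTensor g (x ⊗ₜ[k] y) = g x * g y := by
  simp [mulTensor]

/-- `T(V) / ⟨R⟩` for a subspace `R ⊆ V ⊗ V`. -/
abbrev QuadAlg {V : Type v} [AddCommGroup V] [Module k V] (R : Submodule k (V ⊗[k] V)) : Type _ :=
  RingQuot (fun s t : TensorAlgebra k V =>
    t = 0 ∧ ∃ r ∈ R, s = mulTensor (TensorAlgebra.ι k (M := V)) r)

/-- The generators: the canonical linear map `V → T(V) / ⟨R⟩`. -/
noncomputable def QuadAlg.ι {V : Type v} [AddCommGroup V] [Module k V]
    (R : Submodule k (V ⊗[k] V)) : V →ₗ[k] QuadAlg R :=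
  (RingQuot.mkAlgHom k _).toLinearMap.comp (TensorAlgebra.ι k)

theorem lift_mulTensor {V : Type v} [AddCommGroup V] [Module k V]
    {A : Type w} [Ring A] [Algebra k A] (g : V →ₗ[k] A) (r : V ⊗[k] V) :
    TensorAlgebra.lift k g (mulTensor (TensorAlgebra.ι k (M := V)) r) = mulTensor g r := by
  induction r using TensorProduct.induction_on with
  | zero => simp
  | tmul x y => simp [mulTensor_tmul]
  | add x y hx hy => simp only [map_add, hx, hy]

/-- The universal property of `T(V) / ⟨R⟩`. -/
noncomputable def QuadAlg.lift {V : Type v} [AddCommGroup V] [Module k V]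
    (R : Submodule k (V ⊗[k] V)) {A : Type w} [Ring A] [Algebra k A] (g : V →ₗ[k] A)
    (h : ∀ r ∈ R, mulTensor g r = 0) : QuadAlg R →ₐ[k] A :=
  RingQuot.liftAlgHom k ⟨TensorAlgebra.lift k g, by
    rintro s t ⟨rfl, r, hr, rfl⟩
    rw [lift_mulTensor, h r hr, map_zero]⟩

theorem QuadAlg.lift_ι {V : Type v} [AddCommGroup V] [Module k V]
    (R : Submodule k (V ⊗[k] V)) {A : Type w} [Ring A] [Algebra k A] (g : V →ₗ[k] A)
    (h : ∀ r ∈ R, mulTensor g r = 0) (x : V) : QuadAlg.lift R g h (QuadAlg.ι R x) = g x := by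
  simp [QuadAlg.lift, QuadAlg.ι, RingQuot.liftAlgHom_mkAlgHom_apply]

theorem QuadAlg.mulTensor_ι {V : Type v} [AddCommGroup V] [Module k V]
    (R : Submodule k (V ⊗[k] V)) (r : V ⊗[k] V) (hr : r ∈ R) :
    mulTensor (QuadAlg.ι R) r = 0 := by
  have h : mulTensor (QuadAlg.ι R) r
      = RingQuot.mkAlgHom k (fun s t : TensorAlgebra k V =>
          t = 0 ∧ ∃ r ∈ R, s = mulTensor (TensorAlgebra.ι k (M := V)) r)
        (mulTensor (TensorAlgebra.ι k (M := V)) r) := by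
    clear hr
    induction r using TensorProduct.induction_on with
    | zero => simp
    | tmul x y =>
      rw [mulTensor_tmul, mulTensor_tmul, map_mul]
      rfl
    | add x y hx hy => simp only [map_add, hx, hy]
  rw [h]
  exact (RingQuot.mkAlgHom_rel k ⟨rfl, r, hr, rfl⟩).trans (map_zero _)

/-- The orthogonal complement `R^⊥ ⊆ V* ⊗ V*` of `R ⊆ V ⊗ V` for the pairing
`⟨f ⊗ g, x ⊗ y⟩ = f x * g y`. -/
noncomputable def perp {V : Type v} [AddCommGroup V] [Module k V] (R : Submodule k (V ⊗[k] V)) :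
    Submodule k (Module.Dual k V ⊗[k] Module.Dual k V) :=
  R.dualAnnihilator.comap (TensorProduct.dualDistrib k V V)

/-- A linear map `π : W → V` with `(π ⊗ π)(S) ⊆ R` induces the algebra homomorphism
`T(V*) / ⟨R^⊥⟩ → T(W*) / ⟨S^⊥⟩` which is `ξ ↦ ξ ∘ π` on the generators. -/
noncomputable def dualAlgHom {V : Type v} [AddCommGroup V] [Module k V]
    {W : Type w} [AddCommGroup W] [Module k W]
    (R : Submodule k (V ⊗[k] V)) (S : Submodule k (W ⊗[k] W)) (π : W →ₗ[k] V)
    (h : ∀ s ∈ S, TensorProduct.map π π s ∈ R) : QuadAlg (perp R) →ₐ[k] QuadAlg (perp S) :=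
  QuadAlg.lift (perp R) ((QuadAlg.ι (perp S)).comp π.dualMap) (by
    intro r hr
    have h1 : mulTensor ((QuadAlg.ι (perp S)).comp π.dualMap) r
        = mulTensor (QuadAlg.ι (perp S)) (TensorProduct.map π.dualMap π.dualMap r) := by
      clear hr
      induction r using TensorProduct.induction_on with
      | zero => simp only [map_zero]
      | tmul x y =>
        rw [TensorProduct.map_tmul, mulTensor_tmul, mulTensor_tmul]
        rfl
      | add x y hx hy => simp only [map_add, hx, hy]
    rw [h1]
    apply QuadAlg.mulTensor_ι
    have h2 : ∀ s, TensorProduct.dualDistrib k W W (TensorProduct.map π.dualMap π.dualMap r) s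
        = TensorProduct.dualDistrib k V V r (TensorProduct.map π π s) := by
      intro s
      clear h1 hr
      induction r using TensorProduct.induction_on with
      | zero => simp
      | add x y hx hy => simp only [map_add, LinearMap.add_apply, hx, hy]
      | tmul f g =>
        induction s using TensorProduct.induction_on with
        | zero => simp
        | add x y hx hy => simp only [map_add, hx, hy]
        | tmul a b => simp
    simp only [perp, Submodule.mem_comap, Submodule.mem_dualAnnihilator] at hr ⊢
    intro s hs
    rw [h2]
    exact hr _ (h s hs))

end QuadraticAlgebras

section GradedAlgebras

variable {k : Type u} [Field k] {A : Type v} [Ring A] [Algebra k A]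

/-- The quadratic relations of a graded algebra: the kernel of the multiplication
`A₁ ⊗ A₁ → A₂`. -/
noncomputable def relations (𝒜 : ℕ → Submodule k A) : Submodule k (𝒜 1 ⊗[k] 𝒜 1) :=
  LinearMap.ker (mulTensor (𝒜 1).subtype)

/-- A graded algebra is quadratic: it is connected, `A₁` is finite-dimensional, and
`A = T(A₁) / ⟨R⟩`, where `R ⊆ A₁ ⊗ A₁` is the space of its quadratic relations. -/
structure IsQuadratic (𝒜 : ℕ → Submodule k A) : Prop where
  nontrivial : Nontrivial A
  connected : 𝒜 0 = 1
  finite : FiniteDimensional k (𝒜 1)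
  bijective : Function.Bijective
    (QuadAlg.lift (relations 𝒜) (𝒜 1).subtype (fun _ hr => hr))

/-- A linear resolution of the trivial left module `A / A₊`: an exact sequence
`⋯ → P₂ → P₁ → P₀ → A / A₊ → 0` of graded left modules and homomorphisms of degree zero with `Pₙ`
projective and generated in degree `n`. (As `A` lives in degrees `≥ 0`, such a `Pₙ` lives in
degrees `≥ n`, so that gradings by `ℕ` suffice, and every module map `P₀ → A / A₊` is graded.) -/
structure LinearResolution (𝒜 : ℕ → Submodule k A) [GradedAlgebra 𝒜] where
  P : ℕ → Type v
  [addCommGroup : ∀ n, AddCommGroup (P n)]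
  [module : ∀ n, Module A (P n)]
  grading : ∀ n, ℕ → AddSubgroup (P n)
  isInternal : ∀ n, DirectSum.IsInternal (grading n)
  smul_mem : ∀ n i j, ∀ a ∈ 𝒜 i, ∀ x ∈ grading n j, a • x ∈ grading n (i + j)
  projective : ∀ n, Module.Projective A (P n)
  generated : ∀ n, Submodule.span A (grading n n : Set (P n)) = ⊤
  d : ∀ n, P (n + 1) →ₗ[A] P n
  d_mem : ∀ n j, ∀ x ∈ grading (n + 1) j, d n x ∈ grading n j
  ε : P 0 →ₗ[A] A ⧸ (HomogeneousIdeal.irrelevant 𝒜).toIdeal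
  ε_surjective : Function.Surjective ε
  exact_zero : Function.Exact (d 0) ε
  exact_succ : ∀ n, Function.Exact (d (n + 1)) (d n)

/-- Koszul algebras. -/
structure IsKoszul (𝒜 : ℕ → Submodule k A) [GradedAlgebra 𝒜] : Prop where
  isQuadratic : IsQuadratic 𝒜
  resolution : Nonempty (LinearResolution 𝒜)

/-- The homogeneous dual `A^! = T(A₁*) / ⟨R^⊥⟩`. -/
abbrev KoszulDual (𝒜 : ℕ → Submodule k A) : Type _ := QuadAlg (perp (relations 𝒜))

/-- The element of `A^!` of degree one given by a linear form on `A₁`. -/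
noncomputable abbrev KoszulDual.ι (𝒜 : ℕ → Submodule k A) :
    Module.Dual k (𝒜 1) →ₗ[k] KoszulDual 𝒜 :=
  QuadAlg.ι (perp (relations 𝒜))

end GradedAlgebras

section FreeModules

/-- Along a ring homomorphism `f : R → S`, the family `v` is a basis of `S` as a left `R`-module:
every `s` is `∑ j, f (c j) * v j` for exactly one finitely supported family `c`. -/
def IsLeftBasis {R S J : Type*} [Ring R] [Ring S] (f : R →+* S) (v : J → S) : Prop :=
  Function.Bijective (fun c : J →₀ R => c.sum fun j a => f a * v j)

/-- The same for `S` as a right `R`-module. -/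
def IsRightBasis {R S J : Type*} [Ring R] [Ring S] (f : R →+* S) (v : J → S) : Prop :=
  Function.Bijective (fun c : J →₀ R => c.sum fun j a => v j * f a)

end FreeModules

section DoubleOre

variable {k : Type u} [Field k] {A : Type v} [Ring A] [Algebra k A]
  {B : Type w} [Ring B] [Algebra k B]

/-- `B = A_P[y₁, y₂; σ, δ, τ]` is a right double Ore extension of `A`, which is embedded by `i`;
the indices `0`, `1` of `Fin 2` stand for the variables `y₁`, `y₂`. -/
structure IsRightDoubleOre (i : A →ₐ[k] B) (y₁ y₂ : B) (p q : k)
    (σ : A → Matrix (Fin 2) (Fin 2) A) (δ : A → Fin 2 → A) (τ₀ τ₁ τ₂ : A) : Prop where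
  injective : Function.Injective i
  generated : Algebra.adjoin k (Set.range i ∪ {y₁, y₂}) = ⊤
  relation : y₂ * y₁ = p • (y₁ * y₂) + q • y₁ ^ 2 + i τ₁ * y₁ + i τ₂ * y₂ + i τ₀
  basis : IsLeftBasis (i : A →+* B) (fun m : ℕ × ℕ => y₁ ^ m.1 * y₂ ^ m.2)
  comm₁ : ∀ a, y₁ * i a = i (σ a 0 0) * y₁ + i (σ a 0 1) * y₂ + i (δ a 0)
  comm₂ : ∀ a, y₂ * i a = i (σ a 1 0) * y₁ + i (σ a 1 1) * y₂ + i (δ a 1)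

/-- `B` is a left double Ore extension of `A`, which is embedded by `i`. -/
structure IsLeftDoubleOre (i : A →ₐ[k] B) (y₁ y₂ : B) : Prop where
  injective : Function.Injective i
  generated : Algebra.adjoin k (Set.range i ∪ {y₁, y₂}) = ⊤
  relation : ∃ (p' q' : k) (τ₀ τ₁ τ₂ : A),
    y₁ * y₂ = p' • (y₂ * y₁) + q' • y₁ ^ 2 + i τ₁ * y₁ + i τ₂ * y₂ + i τ₀
  basis : IsRightBasis (i : A →+* B) (fun m : ℕ × ℕ => y₂ ^ m.1 * y₁ ^ m.2)
  comm₁ : ∀ a, ∃ a₁ a₂ a₀ : A, i a * y₁ = y₁ * i a₁ + y₂ * i a₂ + i a₀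
  comm₂ : ∀ a, ∃ a₁ a₂ a₀ : A, i a * y₂ = y₁ * i a₁ + y₂ * i a₂ + i a₀

/-- `B = A_P[y₁, y₂; σ]` is a trimmed right double Ore extension of `A` (that is, `δ = 0` and
`τ = 0`) in the category of graded algebras, with `y₁`, `y₂` of degree one. -/
structure IsTrimmedRightDoubleOre (𝒜 : ℕ → Submodule k A) (ℬ : ℕ → Submodule k B)
    (i : A →ₐ[k] B) (y₁ y₂ : B) (p q : k) (σ : A → Matrix (Fin 2) (Fin 2) A) : Prop where
  rightDoubleOre : IsRightDoubleOre i y₁ y₂ p q σ 0 0 0 0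
  map_mem : ∀ n, ∀ a ∈ 𝒜 n, i a ∈ ℬ n
  y₁_mem : y₁ ∈ ℬ 1
  y₂_mem : y₂ ∈ ℬ 1

namespace IsTrimmedRightDoubleOre

variable {𝒜 : ℕ → Submodule k A} {ℬ : ℕ → Submodule k B}
  {i : A →ₐ[k] B} {y₁ y₂ : B} {p q : k} {σ : A → Matrix (Fin 2) (Fin 2) A}

/-- The linear map `A₁ ⊕ k ⊕ k → B₁`, `(a, s, t) ↦ a + s y₁ + t y₂`. -/
noncomputable def degreeOneMap (hB : IsTrimmedRightDoubleOre 𝒜 ℬ i y₁ y₂ p q σ) :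
    (𝒜 1 × k × k) →ₗ[k] ℬ 1 where
  toFun x := ⟨i x.1 + x.2.1 • y₁ + x.2.2 • y₂,
    add_mem (add_mem (hB.map_mem 1 _ x.1.2) ((ℬ 1).smul_mem _ hB.y₁_mem))
      ((ℬ 1).smul_mem _ hB.y₂_mem)⟩
  map_add' x z := by
    apply Subtype.ext
    simp only [Prod.fst_add, Prod.snd_add, Submodule.coe_add, map_add, add_smul]
    abel
  map_smul' c x := by
    apply Subtype.ext
    simp [smul_add, smul_smul]

/-- The coefficient of `y₁ ^ 0 * y₂ ^ 0` is additive and has the expected values. -/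
theorem exists_coeff (hB : IsTrimmedRightDoubleOre 𝒜 ℬ i y₁ y₂ p q σ) :
    ∃ P : B →+ (ℕ × ℕ →₀ A), Function.Injective P ∧
      ∀ a m n, P (i a * (y₁ ^ m * y₂ ^ n)) = Finsupp.single (m, n) a := by
  classical
  have hb := hB.rightDoubleOre.basis
  let F : (ℕ × ℕ →₀ A) →+ B :=
    { toFun := fun c => c.sum fun j a => (i : A →+* B) a * (y₁ ^ j.1 * y₂ ^ j.2)
      map_zero' := by simp
      map_add' := fun c d => by
        apply Finsupp.sum_add_index'
        · simp
        · intro j a b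
          rw [map_add, add_mul] }
  have hF : Function.Bijective F := hb
  let e := AddEquiv.ofBijective F hF
  refine ⟨e.symm.toAddMonoidHom, e.symm.injective, fun a m n => ?_⟩
  change e.symm _ = _
  rw [AddEquiv.symm_apply_eq]
  change _ = F _
  simp [F]

theorem degreeOneMap_bijective [GradedAlgebra 𝒜] [GradedAlgebra ℬ] (hA : IsQuadratic 𝒜)
    (hB : IsTrimmedRightDoubleOre 𝒜 ℬ i y₁ y₂ p q σ) :
    Function.Bijective hB.degreeOneMap := by
  classical
  have := hA.nontrivial
  obtain ⟨P, hP, hPv⟩ := hB.exists_coeff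
  constructor
  · rw [injective_iff_map_eq_zero]
    rintro ⟨a, s, t⟩ h
    have h0 : i (a : A) + s • y₁ + t • y₂ = 0 := congrArg Subtype.val h
    have h1 : i (a : A) * (y₁ ^ 0 * y₂ ^ 0) + i (algebraMap k A s) * (y₁ ^ 1 * y₂ ^ 0)
        + i (algebraMap k A t) * (y₁ ^ 0 * y₂ ^ 1) = 0 := by
      simpa [Algebra.smul_def] using h0
    have h2 := congrArg P h1
    rw [map_add, map_add, hPv, hPv, hPv, map_zero] at h2
    have ha := DFunLike.congr_fun h2 (0, 0)
    have hs := DFunLike.congr_fun h2 (1, 0)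
    have ht := DFunLike.congr_fun h2 (0, 1)
    simp at ha hs ht
    simp [ha, hs, ht]
  · have key : ∀ (a : A) (m n : ℕ), ∃ x, (hB.degreeOneMap x : B)
        = GradedRing.proj ℬ 1 (i a * (y₁ ^ m * y₂ ^ n)) := by
      intro a m n
      have hy : y₁ ^ m * y₂ ^ n ∈ ℬ (m + n) := by
        have h1 := SetLike.pow_mem_graded m hB.y₁_mem
        have h2 := SetLike.pow_mem_graded n hB.y₂_mem
        simpa using SetLike.mul_mem_graded h1 h2
      induction a using DirectSum.Decomposition.inductionOn 𝒜 with
      | zero => exact ⟨0, by simp⟩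
      | add a b ha hb =>
        obtain ⟨x, hx⟩ := ha
        obtain ⟨z, hz⟩ := hb
        exact ⟨x + z, by rw [map_add, map_add, add_mul, map_add, Submodule.coe_add, hx, hz]⟩
      | @homogeneous d a =>
        have hm : i a * (y₁ ^ m * y₂ ^ n) ∈ ℬ (d + (m + n)) :=
          SetLike.mul_mem_graded (hB.map_mem d a a.2) hy
        by_cases hd : d + (m + n) = 1
        · rw [hd] at hm
          rw [GradedRing.proj_apply, DirectSum.decompose_of_mem_same _ hm]
          have hcases : (d = 1 ∧ m = 0 ∧ n = 0) ∨ (d = 0 ∧ m = 1 ∧ n = 0)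
              ∨ (d = 0 ∧ m = 0 ∧ n = 1) := by omega
          rcases hcases with ⟨rfl, rfl, rfl⟩ | ⟨rfl, rfl, rfl⟩ | ⟨rfl, rfl, rfl⟩
          · exact ⟨(a, 0, 0), by simp [degreeOneMap]⟩
          · have ha : (a : A) ∈ (1 : Submodule k A) := hA.connected ▸ a.2
            obtain ⟨s, hs⟩ := Submodule.mem_one.1 ha
            exact ⟨(0, s, 0), by simp [degreeOneMap, ← hs, Algebra.smul_def]⟩
          · have ha : (a : A) ∈ (1 : Submodule k A) := hA.connected ▸ a.2
            obtain ⟨s, hs⟩ := Submodule.mem_one.1 ha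
            exact ⟨(0, 0, s), by simp [degreeOneMap, ← hs, Algebra.smul_def]⟩
        · rw [GradedRing.proj_apply, DirectSum.decompose_of_mem_ne _ hm hd]
          exact ⟨0, by simp⟩
    have key2 : ∀ c : ℕ × ℕ →₀ A, ∃ x, (hB.degreeOneMap x : B)
        = GradedRing.proj ℬ 1 (c.sum fun j a => (i : A →+* B) a * (y₁ ^ j.1 * y₂ ^ j.2)) := by
      intro c
      choose g hg using key
      refine ⟨∑ j ∈ c.support, g (c j) j.1 j.2, ?_⟩
      rw [Finsupp.sum, map_sum, map_sum, Submodule.coe_sum]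
      exact Finset.sum_congr rfl fun j _ => hg _ _ _
    intro b
    obtain ⟨c, hc⟩ := hB.rightDoubleOre.basis.2 (b : B)
    obtain ⟨x, hx⟩ := key2 c
    refine ⟨x, Subtype.ext ?_⟩
    rw [hx]
    simp only at hc
    rw [hc, GradedRing.proj_apply, DirectSum.decompose_of_mem_same _ b.2]

/-- `B₁ = A₁ ⊕ k y₁ ⊕ k y₂`. -/
noncomputable def degreeOneEquiv [GradedAlgebra 𝒜] [GradedAlgebra ℬ] (hA : IsQuadratic 𝒜)
    (hB : IsTrimmedRightDoubleOre 𝒜 ℬ i y₁ y₂ p q σ) : (𝒜 1 × k × k) ≃ₗ[k] ℬ 1 :=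
  LinearEquiv.ofBijective hB.degreeOneMap (hB.degreeOneMap_bijective hA)

/-- The projection `B₁ = A₁ ⊕ k y₁ ⊕ k y₂ → A₁`. -/
noncomputable def toA [GradedAlgebra 𝒜] [GradedAlgebra ℬ] (hA : IsQuadratic 𝒜)
    (hB : IsTrimmedRightDoubleOre 𝒜 ℬ i y₁ y₂ p q σ) : ℬ 1 →ₗ[k] 𝒜 1 :=
  (LinearMap.fst k (𝒜 1) (k × k)).comp (hB.degreeOneEquiv hA).symm.toLinearMap

/-- The linear form on `B₁ = A₁ ⊕ k y₁ ⊕ k y₂` that is `1` at `y₁` and zero on `A₁` and at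
`y₂`, as an element `y₁*` of `B^!`. -/
noncomputable def y₁Dual [GradedAlgebra 𝒜] [GradedAlgebra ℬ] (hA : IsQuadratic 𝒜)
    (hB : IsTrimmedRightDoubleOre 𝒜 ℬ i y₁ y₂ p q σ) : KoszulDual ℬ :=
  KoszulDual.ι ℬ (((LinearMap.fst k k k).comp (LinearMap.snd k (𝒜 1) (k × k))).comp
    (hB.degreeOneEquiv hA).symm.toLinearMap)

/-- The linear form on `B₁ = A₁ ⊕ k y₁ ⊕ k y₂` that is `1` at `y₂` and zero on `A₁` and at
`y₁`, as an element `y₂*` of `B^!`. -/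
noncomputable def y₂Dual [GradedAlgebra 𝒜] [GradedAlgebra ℬ] (hA : IsQuadratic 𝒜)
    (hB : IsTrimmedRightDoubleOre 𝒜 ℬ i y₁ y₂ p q σ) : KoszulDual ℬ :=
  KoszulDual.ι ℬ (((LinearMap.snd k k k).comp (LinearMap.snd k (𝒜 1) (k × k))).comp
    (hB.degreeOneEquiv hA).symm.toLinearMap)

theorem map_toA_mem_relations [GradedAlgebra 𝒜] [GradedAlgebra ℬ] (hA : IsQuadratic 𝒜)
    (hB : IsTrimmedRightDoubleOre 𝒜 ℬ i y₁ y₂ p q σ) (r : ℬ 1 ⊗[k] ℬ 1)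
    (hr : r ∈ relations ℬ) :
    TensorProduct.map (hB.toA hA) (hB.toA hA) r ∈ relations 𝒜 := by
  classical
  obtain ⟨P, -, hPv⟩ := hB.exists_coeff
  have hrel : y₂ * y₁ = p • (y₁ * y₂) + q • y₁ ^ 2 := by
    simpa using hB.rightDoubleOre.relation
  have hc₁ : ∀ a, y₁ * i a = i (σ a 0 0) * y₁ + i (σ a 0 1) * y₂ := fun a => by
    simpa using hB.rightDoubleOre.comm₁ a
  have hc₂ : ∀ a, y₂ * i a = i (σ a 1 0) * y₁ + i (σ a 1 1) * y₂ := fun a => by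
    simpa using hB.rightDoubleOre.comm₂ a
  have v0 : ∀ a, P (i a) (0, 0) = a := fun a => by
    have := hPv a 0 0
    simp only [pow_zero, mul_one] at this
    simp [this]
  have v1 : ∀ a, P (i a * y₁) (0, 0) = 0 := fun a => by
    have := hPv a 1 0
    simp only [pow_zero, pow_one, mul_one] at this
    simp [this]
  have v2 : ∀ a, P (i a * y₂) (0, 0) = 0 := fun a => by
    have := hPv a 0 1
    simp only [pow_zero, pow_one, one_mul] at this
    simp [this]
  have v11 : ∀ a, P (i a * (y₁ * y₁)) (0, 0) = 0 := fun a => by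
    have := hPv a 2 0
    simp only [pow_zero, pow_two, mul_one] at this
    simp [this]
  have v12 : ∀ a, P (i a * (y₁ * y₂)) (0, 0) = 0 := fun a => by
    have := hPv a 1 1
    simp only [pow_one] at this
    simp [this]
  have v22 : ∀ a, P (i a * (y₂ * y₂)) (0, 0) = 0 := fun a => by
    have := hPv a 0 2
    simp only [pow_zero, pow_two, one_mul] at this
    simp [this]
  have hmul : ∀ (a b : A) (s t s' t' : k),
      P ((i a + s • y₁ + t • y₂) * (i b + s' • y₁ + t' • y₂)) (0, 0) = a * b := by
    intro a b s t s' t'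
    have sm : ∀ (c : k) (z : B), c • z = i (algebraMap k A c) * z := fun c z => by
      rw [AlgHom.commutes, Algebra.smul_def]
    have e : (i a + s • y₁ + t • y₂) * (i b + s' • y₁ + t' • y₂)
        = i (a * b) + i (s' • a + s • σ b 0 0 + t • σ b 1 0) * y₁
          + i (t' • a + s • σ b 0 1 + t • σ b 1 1) * y₂
          + i (algebraMap k A (s * s' + t * s' * q)) * (y₁ * y₁)
          + i (algebraMap k A (s * t' + t * s' * p)) * (y₁ * y₂)
          + i (algebraMap k A (t * t')) * (y₂ * y₂) := by
      rw [← sm, ← sm, ← sm]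
      simp only [add_mul, mul_add, smul_mul_assoc, mul_smul_comm, hc₁, hc₂, hrel, map_mul,
        map_add, map_smul, smul_add, smul_smul, add_smul, pow_two]
      rw [show t * s' * p = s' * (t * p) by ring, show t * s' * q = s' * (t * q) by ring,
        mul_comm s s', mul_comm s t', mul_comm t t']
      abel
    rw [e]
    simp only [map_add P, Finsupp.add_apply, v0, v1, v2, v11, v12, v22, add_zero]
  have hgen : ∀ r : ℬ 1 ⊗[k] ℬ 1, P (mulTensor (ℬ 1).subtype r) (0, 0)
      = mulTensor (𝒜 1).subtype (TensorProduct.map (hB.toA hA) (hB.toA hA) r) := by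
    intro r
    induction r using TensorProduct.induction_on with
    | zero => simp
    | add x z hx hz => simp only [map_add, Finsupp.add_apply, hx, hz]
    | tmul b c =>
      obtain ⟨⟨a, s, t⟩, rfl⟩ := (hB.degreeOneEquiv hA).surjective b
      obtain ⟨⟨a', s', t'⟩, rfl⟩ := (hB.degreeOneEquiv hA).surjective c
      have h := hmul a a' s t s' t'
      have hA' : ∀ x, hB.toA hA (hB.degreeOneEquiv hA x) = x.1 := fun x => by
        change ((hB.degreeOneEquiv hA).symm (hB.degreeOneEquiv hA x)).1 = x.1
        rw [LinearEquiv.symm_apply_apply]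
      rw [TensorProduct.map_tmul, mulTensor_tmul, mulTensor_tmul, hA', hA']
      exact h
  have h0 : mulTensor (ℬ 1).subtype r = 0 := hr
  change mulTensor (𝒜 1).subtype _ = 0
  rw [← hgen, h0]
  simp

/-- The canonical map `A^! → B^!`: on degree one it extends a linear form on `A₁` to
`B₁ = A₁ ⊕ k y₁ ⊕ k y₂` by zero on `y₁` and `y₂`. -/
noncomputable def dualMap [GradedAlgebra 𝒜] [GradedAlgebra ℬ] (hA : IsQuadratic 𝒜)
    (hB : IsTrimmedRightDoubleOre 𝒜 ℬ i y₁ y₂ p q σ) : KoszulDual 𝒜 →ₐ[k] KoszulDual ℬ :=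
  dualAlgHom (relations 𝒜) (relations ℬ) (hB.toA hA) (hB.map_toA_mem_relations hA)

end IsTrimmedRightDoubleOre

end DoubleOre

end KoszulOre

/-!
Write `y_0 = y₁`, `y_1 = y₂`, and let `ρ` be the matrix of the relation between the two variables.
As `B` is free over `A`, its quadratic relations are those of `A`, the commutation relations
`y_j a = ∑ l, σ_jl(a) y_l` with `a ∈ A₁`, and the single relation `∑ ρ_jl y_j y_l = 0`. The
orthogonal complement consists of `R_A^⊥` and the relations `f y_l* = -∑ j, y_j* (f ∘ σ_jl)`,
`y_l* y_m* = ρ_lm y_1* y_0*`. Hence `1, y_0*, y_1*, y_1* y_0*` span `B^!` as a right `A^!`-module.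
These rules also define an action of `B^!` by `4 × 4` matrices over `A^!`; it is well defined
because `σ` respects `R_A` and the relation between the variables. The first column of such a
matrix contains the coefficients of the element, so the four elements are independent, which gives
injectivity and, since `y_0* y_1* = -p y_1* y_0*`, the right basis for `p ≠ 0`.

If `B` is also a left double Ore extension, then `p ≠ 0` and `σ` is invertible on `A₁`. So every
`y_j* f` is a combination of the `g y_l*`, and `f` commutes with `y_1* y_0*` up to the endomorphism
of `A^!` induced by the `P`-determinant of `σ`. The latter is invertible on `A₁` because `σ` is, and
preserves the finite-dimensional space `R_A`, so it induces an automorphism of `A^!`. Hence the four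
elements span `B^!` also as a left `A^!`-module, and multiplying a left linear relation from the
right by `y_1* y_0*`, `y_1*` and `y_0*` isolates its coefficients.
-/

namespace KoszulOre

theorem IsRightBasis.injective {R S J : Type*} [Ring R] [Ring S] {f : R →+* S} {v : J → S}
    (h : IsRightBasis f v) {j : J} (hj : v j = 1) : Function.Injective f := by
  intro a b hab
  refine Finsupp.single_injective j (h.1 ?_)
  simpa [hj] using hab

section Bases

variable {k R S J : Type*} [CommRing k] [Ring R] [Ring S] [Algebra k R] [Algebra k S] [Fintype J]

/-- The combination `∑ j, v j * f (c j)` with coefficients on the right: `v` is a right basis if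
and only if this map is bijective. -/
def rightComb (f : R →+* S) (v : J → S) : (J → R) →+ S where
  toFun c := ∑ j, v j * f (c j)
  map_zero' := by simp
  map_add' c d := by simp [mul_add, Finset.sum_add_distrib]

/-- The combination `∑ j, f (c j) * v j` with coefficients on the left: `v` is a left basis if and
only if this map is bijective. -/
def leftComb (f : R →+* S) (v : J → S) : (J → R) →+ S where
  toFun c := ∑ j, f (c j) * v j
  map_zero' := by simp
  map_add' c d := by simp [add_mul, Finset.sum_add_distrib]

theorem rightComb_apply (f : R →+* S) (v : J → S) (c : J → R) :
    rightComb f v c = ∑ j, v j * f (c j) := rfl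

theorem leftComb_apply (f : R →+* S) (v : J → S) (c : J → R) :
    leftComb f v c = ∑ j, f (c j) * v j := rfl

theorem isRightBasis_iff_bijective (f : R →+* S) (v : J → S) :
    IsRightBasis f v ↔ Function.Bijective (rightComb f v) := by
  rw [IsRightBasis, ← Finsupp.equivFunOnFinite.symm.bijective.of_comp_iff]
  congr! 1
  ext c
  simp [rightComb_apply, Finsupp.sum_fintype]

theorem isLeftBasis_iff_bijective (f : R →+* S) (v : J → S) :
    IsLeftBasis f v ↔ Function.Bijective (leftComb f v) := by
  rw [IsLeftBasis, ← Finsupp.equivFunOnFinite.symm.bijective.of_comp_iff]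
  congr! 1
  ext c
  simp [leftComb_apply, Finsupp.sum_fintype]

theorem mul_map_mem_range_rightComb {f : R →+* S} {v : J → S} {x : S}
    (hx : x ∈ (rightComb f v).range) (a : R) : x * f a ∈ (rightComb f v).range := by
  obtain ⟨c, rfl⟩ := hx
  exact ⟨fun j => c j * a, by simp [rightComb_apply, Finset.sum_mul, mul_assoc]⟩

theorem map_mul_mem_range_leftComb {f : R →+* S} {v : J → S} {x : S}
    (hx : x ∈ (leftComb f v).range) (a : R) : f a * x ∈ (leftComb f v).range := by
  obtain ⟨c, rfl⟩ := hx
  exact ⟨fun j => a * c j, by simp [leftComb_apply, Finset.mul_sum, mul_assoc]⟩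

theorem mem_range_rightComb (f : R →+* S) (v : J → S) (j : J) :
    v j ∈ (rightComb f v).range := by
  classical
  exact ⟨Pi.single j 1, (Fintype.sum_eq_single j fun m hm => by simp [hm]).trans (by simp)⟩

theorem mem_range_leftComb (f : R →+* S) (v : J → S) (j : J) :
    v j ∈ (leftComb f v).range := by
  classical
  exact ⟨Pi.single j 1, (Fintype.sum_eq_single j fun m hm => by simp [hm]).trans (by simp)⟩

theorem rightComb_surjective {f : R →ₐ[k] S} {v : J → S} {T : Set S}
    (hT : Algebra.adjoin k T = ⊤) (h1 : 1 ∈ (rightComb (f : R →+* S) v).range)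
    (hmul : ∀ t ∈ T, ∀ j, t * v j ∈ (rightComb (f : R →+* S) v).range) :
    Function.Surjective (rightComb (f : R →+* S) v) := by
  suffices h : ∀ x, ∀ y ∈ (rightComb (f : R →+* S) v).range,
      x * y ∈ (rightComb (f : R →+* S) v).range from
    fun x => by simpa using h x 1 h1
  intro x
  induction (hT ▸ Algebra.mem_top : x ∈ Algebra.adjoin k T) using Algebra.adjoin_induction with
  | mem t ht =>
    rintro _ ⟨c, rfl⟩
    rw [rightComb_apply, Finset.mul_sum]
    refine sum_mem fun j _ => ?_
    rw [← mul_assoc]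
    exact mul_map_mem_range_rightComb (hmul t ht j) _
  | algebraMap r =>
    intro y hy
    rw [Algebra.commutes, ← f.commutes]
    exact mul_map_mem_range_rightComb hy _
  | add a b _ _ ha hb => exact fun y hy => add_mul a b y ▸ add_mem (ha y hy) (hb y hy)
  | mul a b _ _ ha hb => exact fun y hy => mul_assoc a b y ▸ ha _ (hb y hy)

theorem leftComb_surjective {f : R →ₐ[k] S} {v : J → S} {T : Set S}
    (hT : Algebra.adjoin k T = ⊤) (h1 : 1 ∈ (leftComb (f : R →+* S) v).range)
    (hmul : ∀ t ∈ T, ∀ j, v j * t ∈ (leftComb (f : R →+* S) v).range) :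
    Function.Surjective (leftComb (f : R →+* S) v) := by
  suffices h : ∀ x, ∀ y ∈ (leftComb (f : R →+* S) v).range,
      y * x ∈ (leftComb (f : R →+* S) v).range from
    fun x => by simpa using h x 1 h1
  intro x
  induction (hT ▸ Algebra.mem_top : x ∈ Algebra.adjoin k T) using Algebra.adjoin_induction with
  | mem t ht =>
    rintro _ ⟨c, rfl⟩
    rw [leftComb_apply, Finset.sum_mul]
    refine sum_mem fun j _ => ?_
    rw [mul_assoc]
    exact map_mul_mem_range_leftComb (hmul t ht j) _
  | algebraMap r =>
    intro y hy
    rw [← Algebra.commutes, ← f.commutes]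
    exact map_mul_mem_range_leftComb hy _
  | add a b _ _ ha hb => exact fun y hy => mul_add y a b ▸ add_mem (ha y hy) (hb y hy)
  | mul a b _ _ ha hb => exact fun y hy => mul_assoc y a b ▸ hb _ (ha y hy)

theorem matrix_apply_eq_ite_of_adjoin [DecidableEq J] {Ψ : R →ₐ[k] Matrix J J R} {T : Set R}
    (hT : Algebra.adjoin k T = ⊤) {j : J}
    (hΨ : ∀ t ∈ T, ∀ m, Ψ t m j = if m = j then t else 0) (a : R) (m : J) :
    Ψ a m j = if m = j then a else 0 := by
  induction (hT ▸ Algebra.mem_top : a ∈ Algebra.adjoin k T) using Algebra.adjoin_induction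
    generalizing m with
  | mem t ht => exact hΨ t ht m
  | algebraMap r => simp [Matrix.algebraMap_matrix_apply]
  | add a b _ _ ha hb => simp [ha, hb, ite_add_ite]
  | mul a b _ _ ha hb => simp [Matrix.mul_apply, ha, hb]

/-- The representation `Λ` plays the role of left multiplication on the free module to be: its
column `j₀` recovers the coefficients. -/
theorem rightComb_injective_of_matrix [DecidableEq J] {f : R →+* S} {v : J → S}
    (Λ : S →+* Matrix J J R) (j₀ : J) (hf : ∀ a m, Λ (f a) m j₀ = if m = j₀ then a else 0)
    (hv : ∀ j m, Λ (v j) m j₀ = if m = j then 1 else 0) :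
    Function.Injective (rightComb f v) := by
  refine (injective_iff_map_eq_zero _).2 fun c hc => funext fun m => ?_
  have h : Λ (∑ j, v j * f (c j)) m j₀ = c m := by
    simp [Matrix.sum_apply, Matrix.mul_apply, hf, hv]
  rw [← h, ← rightComb_apply, hc, map_zero, Matrix.zero_apply, Pi.zero_apply]

end Bases

section UnitsSMul

variable {k R S J : Type*} [CommRing k] [Ring R] [Ring S] [Algebra k R] [Algebra k S] [Finite J]

theorem IsRightBasis.units_smul {f : R →ₐ[k] S} {v : J → S}
    (h : IsRightBasis (f : R →+* S) v) (w : J → kˣ) :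
    IsRightBasis (f : R →+* S) fun j => w j • v j := by
  cases nonempty_fintype J
  rw [isRightBasis_iff_bijective] at h ⊢
  convert h.comp (Equiv.piCongrRight fun j => MulAction.toPerm (w j)).bijective using 1
  ext c
  simp [rightComb_apply, Units.smul_def]

theorem IsLeftBasis.units_smul {f : R →ₐ[k] S} {v : J → S}
    (h : IsLeftBasis (f : R →+* S) v) (w : J → kˣ) :
    IsLeftBasis (f : R →+* S) fun j => w j • v j := by
  cases nonempty_fintype J
  rw [isLeftBasis_iff_bijective] at h ⊢
  convert h.comp (Equiv.piCongrRight fun j => MulAction.toPerm (w j)).bijective using 1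
  ext c
  simp [leftComb_apply, Units.smul_def]

end UnitsSMul

section QuadraticDual

variable {k : Type*} [Field k] {V W : Type*} [AddCommGroup V] [Module k V] [AddCommGroup W]
  [Module k W]

theorem QuadAlg.adjoin_range_ι (R : Submodule k (V ⊗[k] V)) :
    Algebra.adjoin k (Set.range (QuadAlg.ι R)) = ⊤ := by
  have h : Set.range (QuadAlg.ι R) = RingQuot.mkAlgHom k _ '' Set.range (TensorAlgebra.ι k) :=
    Set.range_comp (RingQuot.mkAlgHom k _) (TensorAlgebra.ι k)
  rw [h, ← AlgHom.map_adjoin, TensorAlgebra.adjoin_range_ι, Algebra.map_top,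
    AlgHom.range_eq_top]
  exact RingQuot.mkAlgHom_surjective k _

theorem mulTensor_comp_map {A : Type*} [Ring A] [Algebra k A] (g : W →ₗ[k] A) (f : V →ₗ[k] W)
    (r : V ⊗[k] V) : mulTensor g (TensorProduct.map f f r) = mulTensor (g ∘ₗ f) r := by
  simp [mulTensor, TensorProduct.map_comp]

theorem mem_perp {R : Submodule k (V ⊗[k] V)} {x : Module.Dual k V ⊗[k] Module.Dual k V} :
    x ∈ perp R ↔ ∀ r ∈ R, TensorProduct.dualDistrib k V V x r = 0 := by
  simp [perp, Submodule.mem_dualAnnihilator]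

theorem dualDistrib_map_dualMap (f g : V →ₗ[k] W) (x : Module.Dual k W ⊗[k] Module.Dual k W)
    (r : V ⊗[k] V) :
    TensorProduct.dualDistrib k V V (TensorProduct.map f.dualMap g.dualMap x) r
      = TensorProduct.dualDistrib k W W x (TensorProduct.map f g r) := by
  induction x with
  | zero => simp
  | add x y hx hy => simp only [map_add, LinearMap.add_apply, hx, hy]
  | tmul ξ η =>
    induction r with
    | zero => simp
    | add x y hx hy => simp only [map_add, hx, hy]
    | tmul a b => simp

theorem dualAlgHom_ι (R : Submodule k (V ⊗[k] V)) (S : Submodule k (W ⊗[k] W)) (π : W →ₗ[k] V)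
    (h : ∀ s ∈ S, TensorProduct.map π π s ∈ R) (f : Module.Dual k V) :
    dualAlgHom R S π h (QuadAlg.ι (perp R) f) = QuadAlg.ι (perp S) (f ∘ₗ π) :=
  QuadAlg.lift_ι _ _ _ f

/-- The matrix of linear maps `f ↦ g (f ∘ M i j)` attached to a matrix `M` of endomorphisms
of `V`. -/
def dualMatrix {n A : Type*} [Ring A] [Algebra k A] (g : Module.Dual k V →ₗ[k] A)
    (M : Matrix n n (Module.End k V)) : Module.Dual k V →ₗ[k] Matrix n n A where
  toFun f := .of fun i j => g (f ∘ₗ M i j)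
  map_add' f f' := by ext; simp [LinearMap.add_comp]
  map_smul' c f := by ext; simp [LinearMap.smul_comp]

theorem dualMatrix_apply {n A : Type*} [Ring A] [Algebra k A] (g : Module.Dual k V →ₗ[k] A)
    (M : Matrix n n (Module.End k V)) (f : Module.Dual k V) (i j : n) :
    dualMatrix g M f i j = g (f ∘ₗ M i j) := rfl

theorem mulTensor_dualMatrix {n A : Type*} [Fintype n] [DecidableEq n] [Ring A] [Algebra k A]
    {g : Module.Dual k V →ₗ[k] A} {R : Submodule k (V ⊗[k] V)}
    (hg : ∀ x ∈ perp R, mulTensor g x = 0) {M : Matrix n n (Module.End k V)}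
    (hM : ∀ r ∈ R, ∀ i j, ∑ m, TensorProduct.map (M i m) (M m j) r ∈ R)
    {x : Module.Dual k V ⊗[k] Module.Dual k V} (hx : x ∈ perp R) :
    mulTensor (dualMatrix g M) x = 0 := by
  ext i j
  have h : mulTensor (dualMatrix g M) x i j
      = mulTensor g (∑ m, TensorProduct.map (M i m).dualMap (M m j).dualMap x) := by
    clear hx
    induction x with
    | zero => simp
    | add x y hx hy => simp only [map_add, Matrix.add_apply, Finset.sum_add_distrib, hx, hy]
    | tmul f f' =>
      simp only [mulTensor_tmul, Matrix.mul_apply, map_sum, TensorProduct.map_tmul]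
      rfl
  rw [h, hg, Matrix.zero_apply]
  refine mem_perp.2 fun r hr => ?_
  simpa only [map_sum, LinearMap.sum_apply, dualDistrib_map_dualMap]
    using mem_perp.1 hx _ (hM r hr i j)

end QuadraticDual

section Splitting

variable {k : Type*} [CommRing k] {V W : Type*} [AddCommGroup V] [Module k V] [AddCommGroup W]
  [Module k W] (e : (V × k × k) ≃ₗ[k] W)

/-- The inclusion of `V` into `W ≅ V ⊕ k ⊕ k`. -/
def incl : V →ₗ[k] W := e.toLinearMap ∘ₗ .inl k V (k × k)

/-- The projection of `W ≅ V ⊕ k ⊕ k` onto `V`. -/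
def proj : W →ₗ[k] V := (LinearMap.fst k V (k × k)).comp e.symm.toLinearMap

/-- The two extra variables, that is, the basis vectors of `k ⊕ k` in `W ≅ V ⊕ k ⊕ k`. -/
def extraVar : Fin 2 → W := ![e (0, 1, 0), e (0, 0, 1)]

/-- The coordinate forms of the extra variables in `W ≅ V ⊕ k ⊕ k`. -/
def extraForm : Fin 2 → Module.Dual k W :=
  ![((LinearMap.fst k k k).comp (LinearMap.snd k V (k × k))).comp e.symm.toLinearMap,
    ((LinearMap.snd k k k).comp (LinearMap.snd k V (k × k))).comp e.symm.toLinearMap]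

@[simp]
theorem proj_incl (a : V) : proj e (incl e a) = a := by simp [proj, incl]

@[simp]
theorem extraForm_incl (j : Fin 2) (a : V) : extraForm e j (incl e a) = 0 := by
  fin_cases j <;> simp [extraForm, incl]

@[simp]
theorem proj_extraVar (j : Fin 2) : proj e (extraVar e j) = 0 := by
  fin_cases j <;> simp [proj, extraVar]

@[simp]
theorem extraForm_extraVar (j l : Fin 2) :
    extraForm e j (extraVar e l) = if j = l then 1 else 0 := by
  fin_cases j <;> fin_cases l <;> simp [extraForm, extraVar]

theorem incl_proj_add_sum_extraVar (x : W) :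
    incl e (proj e x) + ∑ j, extraForm e j x • extraVar e j = x := by
  obtain ⟨y, rfl⟩ := e.surjective x
  simp [proj, incl, extraForm, extraVar, ← map_smul, ← map_add]

theorem dualMap_proj_add_sum_extraForm (ξ : Module.Dual k W) :
    (proj e).dualMap (ξ ∘ₗ incl e) + ∑ j, ξ (extraVar e j) • extraForm e j = ξ := by
  ext x
  simpa [mul_comm] using congrArg ξ (incl_proj_add_sum_extraVar e x)

theorem exists_tensor_decomposition {J : Type*} [Fintype J] {f : V →ₗ[k] W} {Y : J → W}
    (hY : ∀ x, ∃ (a : V) (c : J → k), f a + ∑ j, c j • Y j = x) (x : W ⊗[k] W) :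
    ∃ (r : V ⊗[k] V) (a b : J → V) (c : Matrix J J k),
      TensorProduct.map f f r + ∑ j, f (a j) ⊗ₜ[k] Y j + ∑ j, Y j ⊗ₜ[k] f (b j)
        + ∑ j, ∑ l, c j l • Y j ⊗ₜ[k] Y l = x := by
  induction x with
  | zero => exact ⟨0, 0, 0, 0, by simp⟩
  | add x x' hx hx' =>
    obtain ⟨r, a, b, c, rfl⟩ := hx
    obtain ⟨r', a', b', c', rfl⟩ := hx'
    refine ⟨r + r', a + a', b + b', c + c', ?_⟩
    simp only [map_add, Pi.add_apply, Matrix.add_apply, TensorProduct.add_tmul,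
      TensorProduct.tmul_add, add_smul, Finset.sum_add_distrib]
    abel
  | tmul x x' =>
    obtain ⟨a, c, rfl⟩ := hY x
    obtain ⟨a', c', rfl⟩ := hY x'
    refine ⟨a ⊗ₜ a', fun j => c' j • a, fun j => c j • a', .of fun j l => c j * c' l, ?_⟩
    simp only [TensorProduct.map_tmul, map_smul, TensorProduct.add_tmul, TensorProduct.tmul_add,
      TensorProduct.sum_tmul, TensorProduct.tmul_sum, ← TensorProduct.smul_tmul',
      TensorProduct.tmul_smul, Matrix.of_apply, mul_smul, smul_add, Finset.sum_add_distrib,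
      Finset.smul_sum]
    rw [Finset.sum_comm (f := fun j l => c j • c' l • Y j ⊗ₜ[k] Y l)]
    simp only [smul_comm (c _)]
    abel

end Splitting

section OreRelations

variable {k : Type*} [Field k] {V W : Type*} [AddCommGroup V] [Module k V] [AddCommGroup W]
  [Module k W] (e : (V × k × k) ≃ₗ[k] W) (R : Submodule k (V ⊗[k] V))
  (s : Matrix (Fin 2) (Fin 2) (Module.End k V)) (ρ : Matrix (Fin 2) (Fin 2) k)

/-- The commutation relation `y_j a - ∑ l, s_jl(a) y_l` of an iterated Ore extension. -/
noncomputable def commRelation (j : Fin 2) (a : V) : W ⊗[k] W :=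
  extraVar e j ⊗ₜ incl e a - ∑ l, incl e (s j l a) ⊗ₜ extraVar e l

/-- The relation `∑ ρ_jl y_j y_l` between the two extra variables. -/
noncomputable def varRelation : W ⊗[k] W := ∑ j, ∑ l, ρ j l • extraVar e j ⊗ₜ extraVar e l

/-- The quadratic relations on `W = V ⊕ k y_0 ⊕ k y_1` of the double Ore extension of
`T(V) / ⟨R⟩` with `y_j a = ∑ l, s_jl(a) y_l` for `a ∈ V` and `∑ ρ_jl y_j y_l = 0`. -/
noncomputable def oreRelations : Submodule k (W ⊗[k] W) :=
  R.map (TensorProduct.map (incl e) (incl e)) ⊔ Submodule.span k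
    (Set.range (fun x : Fin 2 × V => commRelation e s x.1 x.2) ∪ {varRelation e ρ})

/-- The relation `f y_l* + ∑ j, y_j* (f ∘ s_jl)` orthogonal to the commutation relations. -/
noncomputable def dualCommRelation (l : Fin 2) (f : Module.Dual k V) :
    Module.Dual k W ⊗[k] Module.Dual k W :=
  (proj e).dualMap f ⊗ₜ extraForm e l + ∑ j, extraForm e j ⊗ₜ (proj e).dualMap (f ∘ₗ s j l)

/-- The relation `y_l* y_m* - ρ_lm y_1* y_0*`, orthogonal to `∑ ρ_jl y_j y_l` if `ρ_10 = 1`. -/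
noncomputable def dualVarRelation (l m : Fin 2) : Module.Dual k W ⊗[k] Module.Dual k W :=
  extraForm e l ⊗ₜ extraForm e m - ρ l m • extraForm e 1 ⊗ₜ extraForm e 0

/-- The quadratic relations on `W*` orthogonal to `oreRelations`. -/
noncomputable def dualOreRelations : Submodule k (Module.Dual k W ⊗[k] Module.Dual k W) :=
  (perp R).map (TensorProduct.map (proj e).dualMap (proj e).dualMap) ⊔ Submodule.span k
    (Set.range (fun x : Fin 2 × Module.Dual k V => dualCommRelation e s x.1 x.2) ∪
      Set.range fun x : Fin 2 × Fin 2 => dualVarRelation e ρ x.1 x.2)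

variable {e R s ρ}

theorem oreRelations_le {S : Submodule k (W ⊗[k] W)} :
    oreRelations e R s ρ ≤ S ↔ (∀ r ∈ R, TensorProduct.map (incl e) (incl e) r ∈ S) ∧
      (∀ j a, commRelation e s j a ∈ S) ∧ varRelation e ρ ∈ S := by
  rw [oreRelations, sup_le_iff, Submodule.map_le_iff_le_comap, Submodule.span_le,
    Set.union_subset_iff, Set.range_subset_iff, Set.singleton_subset_iff, Prod.forall]
  rfl

theorem dualOreRelations_le {S : Submodule k (Module.Dual k W ⊗[k] Module.Dual k W)} :
    dualOreRelations e R s ρ ≤ S ↔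
      (∀ r ∈ perp R, TensorProduct.map (proj e).dualMap (proj e).dualMap r ∈ S) ∧
      (∀ l f, dualCommRelation e s l f ∈ S) ∧ ∀ l m, dualVarRelation e ρ l m ∈ S := by
  rw [dualOreRelations, sup_le_iff, Submodule.map_le_iff_le_comap, Submodule.span_le,
    Set.union_subset_iff, Set.range_subset_iff, Set.range_subset_iff, Prod.forall, Prod.forall]
  rfl

theorem tensor_mem_oreRelations {r : V ⊗[k] V} (hr : r ∈ R) (b : Fin 2 → V) (c : k) :
    TensorProduct.map (incl e) (incl e) r
      + ∑ l, incl e (-∑ j, s j l (b j)) ⊗ₜ extraVar e l + ∑ j, extraVar e j ⊗ₜ incl e (b j)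
      + ∑ j, ∑ l, (c * ρ j l) • extraVar e j ⊗ₜ extraVar e l ∈ oreRelations e R s ρ := by
  obtain ⟨hmap, hcomm, hvar⟩ := oreRelations_le.1 (le_refl (oreRelations e R s ρ))
  have hsum : ∑ j, commRelation e s j (b j) = ∑ l, incl e (-∑ j, s j l (b j)) ⊗ₜ extraVar e l
      + ∑ j, extraVar e j ⊗ₜ incl e (b j) := by
    simp only [commRelation, map_neg, map_sum, TensorProduct.neg_tmul, TensorProduct.sum_tmul,
      Finset.sum_sub_distrib, Finset.sum_neg_distrib, neg_add_eq_sub]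
    rw [Finset.sum_comm (f := fun j l => incl e (s j l (b j)) ⊗ₜ[k] extraVar e l)]
  rw [add_assoc (TensorProduct.map _ _ r), ← hsum]
  simp only [mul_smul, ← Finset.smul_sum]
  exact add_mem (add_mem (hmap r hr) (sum_mem fun j _ => hcomm j (b j)))
    (Submodule.smul_mem _ c hvar)

theorem mem_perp_oreRelations {x : Module.Dual k W ⊗[k] Module.Dual k W} :
    x ∈ perp (oreRelations e R s ρ) ↔
      (∀ r ∈ R, TensorProduct.dualDistrib k W W x (TensorProduct.map (incl e) (incl e) r) = 0) ∧
      (∀ j a, TensorProduct.dualDistrib k W W x (commRelation e s j a) = 0) ∧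
      TensorProduct.dualDistrib k W W x (varRelation e ρ) = 0 := by
  simpa only [SetLike.le_def, LinearMap.mem_ker, mem_perp] using
    oreRelations_le (S := LinearMap.ker (TensorProduct.dualDistrib k W W x))

end OreRelations

section Perp

variable {k : Type*} [Field k] {V W : Type*} [AddCommGroup V] [Module k V] [AddCommGroup W]
  [Module k W] (e : (V × k × k) ≃ₗ[k] W) {R : Submodule k (V ⊗[k] V)}
  (s : Matrix (Fin 2) (Fin 2) (Module.End k V)) (ρ : Matrix (Fin 2) (Fin 2) k)

/-- The general element of `W* ⊗ W*`, where `W ≅ V ⊕ k ⊕ k`. -/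
noncomputable def dualTensor (r : Module.Dual k V ⊗[k] Module.Dual k V)
    (f g : Fin 2 → Module.Dual k V) (c : Matrix (Fin 2) (Fin 2) k) :
    Module.Dual k W ⊗[k] Module.Dual k W :=
  TensorProduct.map (proj e).dualMap (proj e).dualMap r
    + ∑ j, (proj e).dualMap (f j) ⊗ₜ extraForm e j + ∑ j, extraForm e j ⊗ₜ (proj e).dualMap (g j)
    + ∑ j, ∑ l, c j l • extraForm e j ⊗ₜ extraForm e l

variable (r : Module.Dual k V ⊗[k] Module.Dual k V)
    (f g : Fin 2 → Module.Dual k V) (c : Matrix (Fin 2) (Fin 2) k)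

theorem dualDistrib_dualTensor_map_incl (t : V ⊗[k] V) :
    TensorProduct.dualDistrib k W W (dualTensor e r f g c) (TensorProduct.map (incl e) (incl e) t)
      = TensorProduct.dualDistrib k V V r t := by
  have h : TensorProduct.map (incl e).dualMap (incl e).dualMap (dualTensor e r f g c) = r := by
    have h0 : ∀ j, (incl e).dualMap (extraForm e j) = 0 := fun j => by ext; simp
    have h1 : (incl e).dualMap ∘ₗ (proj e).dualMap = .id := by ext; simp
    simp only [dualTensor, map_add, map_sum, map_smul, TensorProduct.map_tmul, h0,
      TensorProduct.tmul_zero, TensorProduct.zero_tmul, smul_zero, Finset.sum_const_zero, add_zero]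
    rw [← LinearMap.comp_apply, ← TensorProduct.map_comp, h1, TensorProduct.map_id,
      LinearMap.id_apply]
  rw [← dualDistrib_map_dualMap, h]

theorem dualDistrib_dualTensor_commRelation (j : Fin 2) (a : V) :
    TensorProduct.dualDistrib k W W (dualTensor e r f g c) (commRelation e s j a)
      = g j a - ∑ l, f l (s j l a) := by
  simp [dualTensor, commRelation, dualDistrib_map_dualMap, neg_add_eq_sub, -Fin.sum_univ_two]

theorem dualDistrib_dualTensor_varRelation :
    TensorProduct.dualDistrib k W W (dualTensor e r f g c) (varRelation e ρ)
      = ∑ j, ∑ l, ρ j l * c j l := by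
  simp [dualTensor, varRelation, dualDistrib_map_dualMap, mul_comm]

variable {e s ρ}

theorem dualTensor_mem_perp_oreRelations :
    dualTensor e r f g c ∈ perp (oreRelations e R s ρ) ↔
      r ∈ perp R ∧ (∀ j, g j = ∑ l, f l ∘ₗ s j l) ∧ ∑ j, ∑ l, ρ j l * c j l = 0 := by
  simp only [mem_perp_oreRelations, dualDistrib_dualTensor_map_incl,
    dualDistrib_dualTensor_commRelation, dualDistrib_dualTensor_varRelation, ← mem_perp,
    sub_eq_zero, LinearMap.ext_iff, LinearMap.sum_apply, LinearMap.comp_apply]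

theorem dualOreRelations_le_perp (hρ : ρ 1 0 = 1) :
    dualOreRelations e R s ρ ≤ perp (oreRelations e R s ρ) := by
  refine dualOreRelations_le.2 ⟨fun r hr => ?_, fun l f => ?_, fun l m => ?_⟩
  · have h : TensorProduct.map (proj e).dualMap (proj e).dualMap r = dualTensor e r 0 0 0 := by
      simp [dualTensor]
    exact h ▸ (dualTensor_mem_perp_oreRelations ..).2 ⟨hr, by simp, by simp⟩
  · have h : dualCommRelation e s l f =
        dualTensor e 0 (Pi.single l f) (fun j => f ∘ₗ s j l) 0 := by
      fin_cases l <;> simp [dualTensor, dualCommRelation]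
    refine h ▸ (dualTensor_mem_perp_oreRelations ..).2 ⟨zero_mem _, fun j => ?_, by simp⟩
    fin_cases l <;> simp
  · have h : dualVarRelation e ρ l m =
        dualTensor e 0 0 0 (Matrix.single l m 1 - ρ l m • Matrix.single 1 0 1) := by
      fin_cases l <;> fin_cases m <;>
        simp [dualTensor, dualVarRelation, Matrix.single_apply, hρ] <;> module
    refine h ▸ (dualTensor_mem_perp_oreRelations ..).2 ⟨zero_mem _, by simp, ?_⟩
    fin_cases l <;> fin_cases m <;> simp [Matrix.single_apply, hρ]

theorem perp_le_dualOreRelations :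
    perp (oreRelations e R s ρ) ≤ dualOreRelations e R s ρ := by
  intro x hx
  obtain ⟨r, f, g, c, rfl⟩ := exists_tensor_decomposition
    (fun ξ => ⟨_, _, dualMap_proj_add_sum_extraForm e ξ⟩) x
  obtain ⟨hr, hg, hc⟩ := (dualTensor_mem_perp_oreRelations r f g c).1 hx
  obtain ⟨h1, h2, h3⟩ := dualOreRelations_le.1 (le_refl (dualOreRelations e R s ρ))
  have hvar : ∀ l m, c l m • extraForm e l ⊗ₜ[k] extraForm e m = c l m • dualVarRelation e ρ l m
      + (ρ l m * c l m) • extraForm e 1 ⊗ₜ extraForm e 0 := fun l m => by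
    rw [dualVarRelation]
    module
  have hsum : ∑ l, ∑ m, c l m • extraForm e l ⊗ₜ[k] extraForm e m
      = ∑ l, ∑ m, c l m • dualVarRelation e ρ l m := by
    simp only [hvar, Finset.sum_add_distrib, ← Finset.sum_smul, hc, zero_smul, add_zero]
  have hcomm : ∑ l, dualCommRelation e s l (f l) = ∑ l, (proj e).dualMap (f l) ⊗ₜ extraForm e l
      + ∑ j, extraForm e j ⊗ₜ (proj e).dualMap (g j) := by
    simp only [dualCommRelation, hg, map_sum, TensorProduct.tmul_sum, Finset.sum_add_distrib]
    rw [Finset.sum_comm]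
  rw [add_assoc (TensorProduct.map _ _ r), ← hcomm, hsum]
  exact add_mem (add_mem (h1 r hr) (sum_mem fun l _ => h2 l (f l)))
    (sum_mem fun l _ => sum_mem fun m _ => Submodule.smul_mem _ (c l m) (h3 l m))

theorem perp_oreRelations (hρ : ρ 1 0 = 1) :
    perp (oreRelations e R s ρ) = dualOreRelations e R s ρ :=
  le_antisymm perp_le_dualOreRelations (dualOreRelations_le_perp hρ)

end Perp

section QuadraticOre

open scoped Matrix

variable {k : Type*} [Field k] {V W : Type*} [AddCommGroup V] [Module k V] [AddCommGroup W]
  [Module k W] {e : (V × k × k) ≃ₗ[k] W} {R : Submodule k (V ⊗[k] V)}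
  {S : Submodule k (W ⊗[k] W)} {s : Matrix (Fin 2) (Fin 2) (Module.End k V)}
  {ρ : Matrix (Fin 2) (Fin 2) k}

/-- The determinant of `s` with respect to the relation `∑ ρ_jl y_j y_l` between the variables; for
the `P`-determinant of Zhang and Zhang, `∑ ρ_jl y_j y_l = y_1 y_0 - p y_0 y_1 - q y_0 y_0`. -/
noncomputable def oreDet (ρ : Matrix (Fin 2) (Fin 2) k)
    (s : Matrix (Fin 2) (Fin 2) (Module.End k V)) : Module.End k V :=
  (sᵀ * ρ.map (algebraMap k (Module.End k V)) * s) 1 0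

theorem oreDet_eq_sum (ρ : Matrix (Fin 2) (Fin 2) k)
    (s : Matrix (Fin 2) (Fin 2) (Module.End k V)) :
    oreDet ρ s = ∑ j, ∑ n, ρ j n • (s j 1 * s n 0) := by
  simp [oreDet, Matrix.mul_apply, Algebra.smul_def, add_mul, Algebra.left_comm, mul_assoc,
    add_add_add_comm]

theorem transpose_mul_mul_eq_iff : sᵀ * ρ.map (algebraMap k (Module.End k V)) * s =
      ρ.map (algebraMap k _) * Matrix.diagonal (fun _ => oreDet ρ s) ↔
    ∀ l m, ∑ j, ∑ n, ρ j n • (s j l * s n m) = ρ l m • oreDet ρ s := by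
  rw [← Matrix.ext_iff]
  simp [Matrix.mul_apply, Matrix.diagonal_apply, Algebra.smul_def, add_mul,
    Algebra.left_comm, mul_assoc, add_add_add_comm]

variable (e R S s ρ) in
/-- `T(W) / ⟨S⟩` is a graded trimmed double Ore extension of `T(V) / ⟨R⟩` as far as relations are
concerned: its relations are those of `oreRelations`, the map `a ↦ (s_jl a)` respects the relations
`R`, and it is compatible with the relation between the two variables. -/
structure IsQuadraticOre : Prop where
  relations_eq : S = oreRelations e R s ρ
  apply_one_zero : ρ 1 0 = 1
  apply_one_one : ρ 1 1 = 0
  sum_map_mem : ∀ r ∈ R, ∀ j l, ∑ m, TensorProduct.map (s j m) (s m l) r ∈ R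
  transpose_mul_mul : sᵀ * ρ.map (algebraMap k (Module.End k V)) * s =
    ρ.map (algebraMap k _) * Matrix.diagonal fun _ => oreDet ρ s

namespace IsQuadraticOre

variable (h : IsQuadraticOre e R S s ρ)

include h

theorem map_proj_mem : ∀ x ∈ S, TensorProduct.map (proj e) (proj e) x ∈ R := by
  have hle : S ≤ R.comap (TensorProduct.map (proj e) (proj e)) := by
    rw [h.relations_eq, oreRelations_le]
    refine ⟨fun r hr => ?_, fun j a => ?_, ?_⟩
    · have hid : proj e ∘ₗ incl e = .id := by ext; simp
      rwa [Submodule.mem_comap, ← LinearMap.comp_apply, ← TensorProduct.map_comp, hid,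
        TensorProduct.map_id]
    · simp [commRelation]
    · simp [varRelation]
  exact hle

theorem sum_mul_oreDet (l m : Fin 2) :
    ∑ j, ∑ n, ρ j n • (s j l * s n m) = ρ l m • oreDet ρ s :=
  transpose_mul_mul_eq_iff.1 h.transpose_mul_mul l m

theorem map_oreDet_mem : ∀ r ∈ R, TensorProduct.map (oreDet ρ s) (oreDet ρ s) r ∈ R := by
  let s₂ (j l : Fin 2) : Module.End k (V ⊗[k] V) := ∑ m, TensorProduct.map (s j m) (s m l)
  have hs₂ : TensorProduct.map (oreDet ρ s) (oreDet ρ s) = ∑ j, ∑ n, ρ j n • (s₂ j 1 * s₂ n 0) :=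
    calc TensorProduct.map (oreDet ρ s) (oreDet ρ s)
      _ = ∑ m, ∑ i, TensorProduct.map (ρ m i • oreDet ρ s) (s m 1 * s i 0) := by
        conv_lhs => enter [2]; rw [oreDet_eq_sum]
        simp only [Fin.sum_univ_two, TensorProduct.map_add_right, TensorProduct.map_smul_right,
          TensorProduct.map_smul_left]
      _ = ∑ m, ∑ i, ∑ j, ∑ n, ρ j n • TensorProduct.map (s j m * s n i) (s m 1 * s i 0) := by
        simp only [← h.sum_mul_oreDet]
        simp only [Fin.sum_univ_two, TensorProduct.map_add_left, TensorProduct.map_smul_left]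
      _ = ∑ j, ∑ n, ρ j n • (s₂ j 1 * s₂ n 0) := by
        simp only [s₂, Fin.sum_univ_two, TensorProduct.map_mul, mul_add, add_mul, smul_add]
        abel
  intro r hr
  have hs₂R : ∀ j l, ∀ r ∈ R, s₂ j l r ∈ R := fun j l r hr => by
    simpa only [s₂, LinearMap.sum_apply] using h.sum_map_mem r hr j l
  simp only [hs₂, LinearMap.sum_apply, LinearMap.smul_apply, Module.End.mul_apply]
  exact sum_mem fun j _ => sum_mem fun n _ =>
    R.smul_mem _ (hs₂R j 1 _ (hs₂R n 0 r hr))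

end IsQuadraticOre

end QuadraticOre

section Representation

variable {k : Type*} [Field k] {V W : Type*} [AddCommGroup V] [Module k V] [AddCommGroup W]
  [Module k W] {e : (V × k × k) ≃ₗ[k] W} {R : Submodule k (V ⊗[k] V)}
  {S : Submodule k (W ⊗[k] W)} {s : Matrix (Fin 2) (Fin 2) (Module.End k V)}
  {ρ : Matrix (Fin 2) (Fin 2) k} {A : Type*} [Ring A] [Algebra k A]

variable (ρ s) in
/-- The endomorphisms by which the coefficients act, from the left and up to transposition, on the
right basis `1, y_0*, y_1*, y_1* y_0*` of the quadratic dual. -/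
noncomputable def coeffAction : Matrix (Fin 4) (Fin 4) (Module.End k V) :=
  !![1, 0, 0, 0; 0, -s 0 0, -s 0 1, 0; 0, -s 1 0, -s 1 1, 0; 0, 0, 0, oreDet ρ s]

variable (A ρ) in
/-- The matrices by which `y_0*` and `y_1*` act from the left on the right basis
`1, y_0*, y_1*, y_1* y_0*` of the quadratic dual. -/
def varAction : Fin 2 → Matrix (Fin 4) (Fin 4) A :=
  ![!![0, 0, 0, 0; 1, 0, 0, 0; 0, 0, 0, 0; 0, ρ 0 0 • 1, ρ 0 1 • 1, 0],
    !![0, 0, 0, 0; 0, 0, 0, 0; 1, 0, 0, 0; 0, ρ 1 0 • 1, ρ 1 1 • 1, 0]]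

variable (e s ρ) in
/-- The left action of `W*` on the right basis `1, y_0*, y_1*, y_1* y_0*`. -/
noncomputable def dualAction (g : Module.Dual k V →ₗ[k] A) :
    Module.Dual k W →ₗ[k] Matrix (Fin 4) (Fin 4) A :=
  dualMatrix g (coeffAction s ρ) ∘ₗ (incl e).dualMap
    + ∑ j, (Module.Dual.eval k W (extraVar e j)).smulRight (varAction ρ A j)

theorem dualAction_comp_dualMap_proj (g : Module.Dual k V →ₗ[k] A) :
    dualAction e s ρ g ∘ₗ (proj e).dualMap = dualMatrix g (coeffAction s ρ) := by
  have h : (incl e).dualMap ∘ₗ (proj e).dualMap = .id := by ext; simp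
  ext1 f
  simp [dualAction, ← LinearMap.comp_apply (incl e).dualMap, h]

theorem dualAction_extraForm (g : Module.Dual k V →ₗ[k] A) (j : Fin 2) :
    dualAction e s ρ g (extraForm e j) = varAction ρ A j := by
  have h : ∀ j, (incl e).dualMap (extraForm e j) = 0 := fun j => by ext; simp
  fin_cases j <;> simp [dualAction, h]

theorem varAction_mul_varAction (hρ : ρ 1 0 = 1) (l m : Fin 2) :
    varAction ρ A l * varAction ρ A m = ρ l m • (varAction ρ A 1 * varAction ρ A 0) := by
  ext i j
  fin_cases l <;> fin_cases m <;> fin_cases i <;> fin_cases j <;>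
    simp [varAction, hρ, Matrix.mul_apply, Fin.sum_univ_four]

namespace IsQuadraticOre

variable (h : IsQuadraticOre e R S s ρ)

include h

theorem sum_map_coeffAction_mem (r : V ⊗[k] V) (hr : r ∈ R) (i j : Fin 4) :
    ∑ m, TensorProduct.map (coeffAction s ρ i m) (coeffAction s ρ m j) r ∈ R := by
  have hs : ∀ i j : Fin 2, _ := h.sum_map_mem r hr
  have hneg : ∀ f g : Module.End k V,
    TensorProduct.map (-f) (-g) r = TensorProduct.map f g r := by
    intro f g
    rw [← neg_one_smul k f, ← neg_one_smul k g, TensorProduct.map_smul_left,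
      TensorProduct.map_smul_right, smul_smul, neg_one_mul, neg_neg, one_smul]
  simp only [Fin.sum_univ_two] at hs
  fin_cases i <;> fin_cases j <;>
    simp [coeffAction, Fin.sum_univ_four, hs, hr, hneg, h.map_oreDet_mem r hr]

theorem dualMatrix_mul_varAction (g : Module.Dual k V →ₗ[k] A) (f : Module.Dual k V)
    (l : Fin 2) : dualMatrix g (coeffAction s ρ) f * varAction ρ A l
      + ∑ j, varAction ρ A j * dualMatrix g (coeffAction s ρ) (f ∘ₗ s j l) = 0 := by
  have hs : ∀ l m, ρ l m • g (f ∘ₗ oreDet ρ s)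
      = ∑ j, ∑ n, ρ j n • g ((f ∘ₗ s j l) ∘ₗ s n m) := fun l m => by
    have hf : ρ l m • (f ∘ₗ oreDet ρ s) = ∑ j, ∑ n, ρ j n • ((f ∘ₗ s j l) ∘ₗ s n m) := by
      rw [← LinearMap.comp_smul, ← h.sum_mul_oreDet]
      ext
      simp
    simp only [← map_smul, ← map_sum, hf]
  simp only [Fin.sum_univ_two] at hs
  ext i j
  fin_cases l <;> fin_cases i <;> fin_cases j <;>
    simp [-Matrix.cons_mul, coeffAction, varAction, dualMatrix_apply, Matrix.mul_apply,
      Fin.sum_univ_four, Module.End.one_eq_id, hs] <;> abel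

theorem mulTensor_dualAction {g : Module.Dual k V →ₗ[k] A}
    (hg : ∀ x ∈ perp R, mulTensor g x = 0) :
    ∀ x ∈ perp S, mulTensor (dualAction e s ρ g) x = 0 := by
  have hle : dualOreRelations e R s ρ ≤ LinearMap.ker (mulTensor (dualAction e s ρ g)) := by
    refine dualOreRelations_le.2 ⟨fun r hr => ?_, fun l f => ?_, fun l m => ?_⟩
    · rw [LinearMap.mem_ker, mulTensor_comp_map, dualAction_comp_dualMap_proj]
      exact mulTensor_dualMatrix hg h.sum_map_coeffAction_mem hr
    · have hf : ∀ f, dualAction e s ρ g ((proj e).dualMap f) = dualMatrix g (coeffAction s ρ) f :=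
        LinearMap.congr_fun (dualAction_comp_dualMap_proj g)
      simp only [dualCommRelation, LinearMap.mem_ker, map_add, map_sum, mulTensor_tmul,
        dualAction_extraForm, hf]
      exact h.dualMatrix_mul_varAction g f l
    · simp only [dualVarRelation, LinearMap.mem_ker, map_sub, map_smul, mulTensor_tmul,
        dualAction_extraForm, varAction_mul_varAction h.apply_one_zero l m, sub_self]
  rw [h.relations_eq, perp_oreRelations h.apply_one_zero]
  exact hle

end IsQuadraticOre

end Representation

section DualOre

variable {k V C D : Type*} [Field k] [AddCommGroup V] [Module k V] [Ring C] [Algebra k C]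
  [Ring D] [Algebra k D] {ι : Module.Dual k V →ₗ[k] C} {φ : C →ₐ[k] D} {y : Fin 2 → D}
  {s : Matrix (Fin 2) (Fin 2) (Module.End k V)} {ρ : Matrix (Fin 2) (Fin 2) k}

variable (ι φ y s ρ) in
/-- `D` is generated over `C`, which in turn is generated by linear forms on `V`, by two elements
`y_0`, `y_1` subject to the relations dual to those of the double Ore extension given by `s`
and `ρ`. -/
structure IsDualOre : Prop where
  adjoin_range_ι : Algebra.adjoin k (Set.range ι) = ⊤
  adjoin_range_union : Algebra.adjoin k (Set.range (φ ∘ ι) ∪ Set.range y) = ⊤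
  map_ι_mul : ∀ f l, φ (ι f) * y l = -∑ j, y j * φ (ι (f ∘ₗ s j l))
  mul_eq_smul : ∀ l m, y l * y m = ρ l m • (y 1 * y 0)
  apply_one_one : ρ 1 1 = 0

namespace IsDualOre

variable (h : IsDualOre ι φ y s ρ)

include h

theorem mul_mul_eq_zero (l m n : Fin 2) : y l * (y m * y n) = 0 := by
  have h₁ : y 1 * (y 1 * y 0) = 0 := by
    rw [← mul_assoc, h.mul_eq_smul, h.apply_one_one, zero_smul, zero_mul]
  have h₂ : y 1 * (y 0 * y 0) = 0 := by rw [h.mul_eq_smul 0 0, mul_smul_comm, h₁, smul_zero]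
  rw [h.mul_eq_smul m n, mul_smul_comm, ← mul_assoc, h.mul_eq_smul l 1, smul_mul_assoc, mul_assoc,
    h₂, smul_zero, smul_zero]

theorem map_ι_mul_mul (f : Module.Dual k V) :
    φ (ι f) * (y 1 * y 0) = y 1 * y 0 * φ (ι (f ∘ₗ oreDet ρ s)) := by
  have hdet : f ∘ₗ oreDet ρ s = ∑ j, ∑ n, ρ j n • (f ∘ₗ s j 1) ∘ₗ s n 0 := by
    rw [oreDet_eq_sum]
    ext
    simp
  calc φ (ι f) * (y 1 * y 0)
    _ = -∑ j, y j * (φ (ι (f ∘ₗ s j 1)) * y 0) := by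
      rw [← mul_assoc, h.map_ι_mul, neg_mul, Finset.sum_mul]
      simp only [mul_assoc]
    _ = ∑ j, ∑ n, y j * y n * φ (ι ((f ∘ₗ s j 1) ∘ₗ s n 0)) := by
      simp only [h.map_ι_mul (_ ∘ₗ _), mul_neg, Finset.sum_neg_distrib, neg_neg, Finset.mul_sum,
        mul_assoc]
    _ = y 1 * y 0 * φ (ι (f ∘ₗ oreDet ρ s)) := by
      simp only [hdet, map_sum, map_smul, Finset.mul_sum, mul_smul_comm, ← smul_mul_assoc,
        ← h.mul_eq_smul]

theorem map_mul_mul {Δ : C →ₐ[k] C} (hΔ : ∀ f, Δ (ι f) = ι (f ∘ₗ oreDet ρ s)) (a : C) :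
    φ a * (y 1 * y 0) = y 1 * y 0 * φ (Δ a) := by
  induction (h.adjoin_range_ι ▸ Algebra.mem_top : a ∈ Algebra.adjoin k (Set.range ι))
    using Algebra.adjoin_induction with
  | mem a ha =>
    obtain ⟨f, rfl⟩ := ha
    rw [h.map_ι_mul_mul, hΔ]
  | algebraMap r => simp only [AlgHom.commutes, Algebra.commutes]
  | add a b _ _ ha hb => simp only [map_add, add_mul, mul_add, ha, hb]
  | mul a b _ _ ha hb => rw [map_mul, mul_assoc, hb, ← mul_assoc, ha, mul_assoc, map_mul, map_mul]

theorem mul_map_ι {t : Matrix (Fin 2) (Fin 2) (Module.End k V)} (ht : t * s.transpose = 1)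
    (j : Fin 2) (f : Module.Dual k V) :
    y j * φ (ι f) = -∑ l, φ (ι (f ∘ₗ t j l)) * y l := by
  have hts : ∀ m, ∑ l, (f ∘ₗ t j l) ∘ₗ s m l = if j = m then f else 0 := fun m => by
    have := congrFun₂ ht j m
    simp only [Matrix.mul_apply, Matrix.transpose_apply, Matrix.one_apply] at this
    calc _ = f ∘ₗ ∑ l, t j l * s m l := by ext; simp
      _ = _ := by rw [this]; split_ifs <;> ext <;> simp
  calc y j * φ (ι f)
    _ = ∑ m, y m * φ (ι (∑ l, (f ∘ₗ t j l) ∘ₗ s m l)) := by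
      simp [hts, apply_ite, -Fin.sum_univ_two]
    _ = -∑ l, φ (ι (f ∘ₗ t j l)) * y l := by
      simp only [h.map_ι_mul, Finset.sum_neg_distrib, neg_neg, map_sum, Finset.mul_sum]
      exact Finset.sum_comm

theorem rightComb_surjective :
    Function.Surjective (rightComb (φ : C →+* D) ![1, y 0, y 1, y 1 * y 0]) := by
  have hv := mem_range_rightComb (φ : C →+* D) ![1, y 0, y 1, y 1 * y 0]
  have hy : ∀ j, y j ∈ (rightComb (φ : C →+* D) ![1, y 0, y 1, y 1 * y 0]).range :=
    Fin.forall_fin_two.2 ⟨hv 1, hv 2⟩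
  refine KoszulOre.rightComb_surjective h.adjoin_range_union (hv 0) fun t ht => ?_
  rcases ht with ⟨f, rfl⟩ | ⟨l, rfl⟩
  · have hf : ∀ l, φ (ι f) * y l ∈ (rightComb (φ : C →+* D) ![1, y 0, y 1, y 1 * y 0]).range :=
      fun l => h.map_ι_mul f l ▸
        neg_mem (sum_mem fun j _ => mul_map_mem_range_rightComb (hy j) _)
    refine Fin.forall_fin_succ.2 ⟨?_, Fin.forall_fin_succ.2 ⟨hf 0, Fin.forall_fin_two.2 ⟨hf 1, ?_⟩⟩⟩
    · simpa using mul_map_mem_range_rightComb (hv 0) (ι f)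
    · exact (h.map_ι_mul_mul f).symm ▸ mul_map_mem_range_rightComb (hv 3) _
  · have hl : ∀ m, y l * y m ∈ (rightComb (φ : C →+* D) ![1, y 0, y 1, y 1 * y 0]).range :=
      fun m => by
      have hz : y l * y m = y 1 * y 0 * φ (algebraMap k C (ρ l m)) := by
        rw [h.mul_eq_smul, φ.commutes, ← Algebra.commutes, ← Algebra.smul_def]
      exact hz ▸ mul_map_mem_range_rightComb (hv 3) _
    refine Fin.forall_fin_succ.2 ⟨?_, Fin.forall_fin_succ.2 ⟨hl 0, Fin.forall_fin_two.2 ⟨hl 1, ?_⟩⟩⟩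
    · simpa using hy l
    · exact (h.mul_mul_eq_zero l 1 0).symm ▸ zero_mem _

theorem leftComb_surjective {Δ : C →ₐ[k] C} (hΔ : ∀ f, Δ (ι f) = ι (f ∘ₗ oreDet ρ s))
    (hΔs : Function.Surjective Δ) {t : Matrix (Fin 2) (Fin 2) (Module.End k V)}
    (ht : t * s.transpose = 1) :
    Function.Surjective (leftComb (φ : C →+* D) ![1, y 0, y 1, y 1 * y 0]) := by
  have hv := mem_range_leftComb (φ : C →+* D) ![1, y 0, y 1, y 1 * y 0]
  have hy : ∀ j, y j ∈ (leftComb (φ : C →+* D) ![1, y 0, y 1, y 1 * y 0]).range :=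
    Fin.forall_fin_two.2 ⟨hv 1, hv 2⟩
  refine KoszulOre.leftComb_surjective h.adjoin_range_union (hv 0) fun x hx => ?_
  rcases hx with ⟨f, rfl⟩ | ⟨l, rfl⟩
  · have hf : ∀ j, y j * φ (ι f) ∈ (leftComb (φ : C →+* D) ![1, y 0, y 1, y 1 * y 0]).range :=
      fun j => h.mul_map_ι ht j f ▸
        neg_mem (sum_mem fun l _ => map_mul_mem_range_leftComb (hy l) _)
    refine Fin.forall_fin_succ.2 ⟨?_, Fin.forall_fin_succ.2 ⟨hf 0, Fin.forall_fin_two.2 ⟨hf 1, ?_⟩⟩⟩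
    · simpa using map_mul_mem_range_leftComb (hv 0) (ι f)
    · obtain ⟨a, ha⟩ := hΔs (ι f)
      change y 1 * y 0 * φ (ι f) ∈ _
      rw [← ha, ← h.map_mul_mul hΔ]
      exact map_mul_mem_range_leftComb (hv 3) _
  · have hl : ∀ j, y j * y l ∈ (leftComb (φ : C →+* D) ![1, y 0, y 1, y 1 * y 0]).range :=
      fun j => by
      have hz : y j * y l = φ (algebraMap k C (ρ j l)) * (y 1 * y 0) := by
        rw [h.mul_eq_smul, φ.commutes, ← Algebra.smul_def]
      exact hz ▸ map_mul_mem_range_leftComb (hv 3) _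
    refine Fin.forall_fin_succ.2 ⟨?_, Fin.forall_fin_succ.2 ⟨hl 0, Fin.forall_fin_two.2 ⟨hl 1, ?_⟩⟩⟩
    · simpa using hy l
    · exact ((mul_assoc _ _ _).trans (h.mul_mul_eq_zero 1 0 l)).symm ▸ zero_mem _

theorem leftComb_injective
    (hr : Function.Injective (rightComb (φ : C →+* D) ![1, y 0, y 1, y 1 * y 0]))
    {Δ : C →ₐ[k] C} (hΔ : ∀ f, Δ (ι f) = ι (f ∘ₗ oreDet ρ s)) (hΔi : Function.Injective Δ)
    (hρ : ρ 0 1 ≠ 0) :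
    Function.Injective (leftComb (φ : C →+* D) ![1, y 0, y 1, y 1 * y 0]) := by
  have hz : ∀ a, φ a * (y 1 * y 0) = 0 → a = 0 := fun a ha => by
    rw [h.map_mul_mul hΔ] at ha
    have := (injective_iff_map_eq_zero _).1 hr ![0, 0, 0, Δ a] (by
      simpa [rightComb_apply, Fin.sum_univ_four] using ha)
    exact (map_eq_zero_iff Δ hΔi).1 (congrFun this 3)
  have hz' : ∀ (a : C) {l m : Fin 2}, ρ l m ≠ 0 → φ a * (y l * y m) = 0 → a = 0 :=
    fun a l m hlm ha => hz a <| by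
      rwa [h.mul_eq_smul, mul_smul_comm, smul_eq_zero_iff_right hlm] at ha
  refine (injective_iff_map_eq_zero _).2 fun c hc => ?_
  replace hc : φ (c 0) + φ (c 1) * y 0 + φ (c 2) * y 1 + φ (c 3) * (y 1 * y 0) = 0 := by
    simpa [leftComb_apply, Fin.sum_univ_four] using hc
  have hmul : ∀ x, φ (c 0) * x + φ (c 1) * (y 0 * x) + φ (c 2) * (y 1 * x)
      + φ (c 3) * (y 1 * (y 0 * x)) = 0 := fun x => by
    simpa only [add_mul, mul_assoc, zero_mul] using congrArg (· * x) hc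
  have h₀ : c 0 = 0 := hz _ <| by
    simpa [h.mul_mul_eq_zero, ← mul_assoc (y 0)] using hmul (y 1 * y 0)
  have h₁ : c 1 = 0 := hz' _ hρ <| by
    simpa [h₀, h.mul_mul_eq_zero, h.mul_eq_smul 1 1, h.apply_one_one] using hmul (y 1)
  have h₂ : c 2 = 0 := hz _ <| by simpa [h₀, h₁, h.mul_mul_eq_zero] using hmul (y 0)
  have h₃ : c 3 = 0 := hz _ <| by simpa [h₀, h₁, h₂] using hc
  funext j
  fin_cases j <;> assumption

theorem injective
    (hr : Function.Injective (rightComb (φ : C →+* D) ![1, y 0, y 1, y 1 * y 0])) :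
    Function.Injective φ :=
  ((isRightBasis_iff_bijective _ _).2 ⟨hr, h.rightComb_surjective⟩).injective (j := 0) rfl

theorem units_smul_eq (hρ : ρ 0 1 ≠ 0) :
    (fun j => (![1, 1, 1, .mk0 _ hρ] : Fin 4 → kˣ) j • (![1, y 0, y 1, y 1 * y 0] : Fin 4 → D) j) =
      ![1, y 0, y 1, y 0 * y 1] := by
  ext j
  fin_cases j <;> simp [Units.smul_def, h.mul_eq_smul 0 1]

theorem isRightBasis
    (hr : Function.Injective (rightComb (φ : C →+* D) ![1, y 0, y 1, y 1 * y 0]))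
    (hρ : ρ 0 1 ≠ 0) : IsRightBasis (φ : C →+* D) ![1, y 0, y 1, y 0 * y 1] := by
  rw [← h.units_smul_eq hρ]
  exact ((isRightBasis_iff_bijective _ _).2 ⟨hr, h.rightComb_surjective⟩).units_smul _

theorem isLeftBasis
    (hr : Function.Injective (rightComb (φ : C →+* D) ![1, y 0, y 1, y 1 * y 0]))
    {Δ : C →ₐ[k] C} (hΔ : ∀ f, Δ (ι f) = ι (f ∘ₗ oreDet ρ s)) (hΔb : Function.Bijective Δ)
    {t : Matrix (Fin 2) (Fin 2) (Module.End k V)} (ht : t * s.transpose = 1) (hρ : ρ 0 1 ≠ 0) :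
    IsLeftBasis (φ : C →+* D) ![1, y 0, y 1, y 0 * y 1] := by
  rw [← h.units_smul_eq hρ]
  exact ((isLeftBasis_iff_bijective _ _).2
    ⟨h.leftComb_injective hr hΔ hΔb.1 hρ, h.leftComb_surjective hΔ hΔb.2 ht⟩).units_smul _

end IsDualOre

end DualOre

namespace IsQuadraticOre

section Duality

variable {k : Type*} [Field k] {V W : Type*} [AddCommGroup V] [Module k V] [AddCommGroup W]
  [Module k W] {e : (V × k × k) ≃ₗ[k] W} {R : Submodule k (V ⊗[k] V)}
  {S : Submodule k (W ⊗[k] W)} {s : Matrix (Fin 2) (Fin 2) (Module.End k V)}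
  {ρ : Matrix (Fin 2) (Fin 2) k}

variable (e S) in
/-- The element `y_j*` of the quadratic dual of `T(W) / ⟨S⟩`. -/
noncomputable abbrev dualVar (j : Fin 2) : QuadAlg (perp S) := QuadAlg.ι (perp S) (extraForm e j)

variable (h : IsQuadraticOre e R S s ρ)

include h

theorem mulTensor_ι_eq_zero {x : Module.Dual k W ⊗[k] Module.Dual k W}
    (hx : x ∈ dualOreRelations e R s ρ) : mulTensor (QuadAlg.ι (perp S)) x = 0 := by
  rw [← perp_oreRelations h.apply_one_zero, ← h.relations_eq] at hx
  exact QuadAlg.mulTensor_ι _ _ hx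

theorem isDualOre : IsDualOre (QuadAlg.ι (perp R)) (dualAlgHom R S (proj e) h.map_proj_mem)
    (dualVar e S) s ρ where
  adjoin_range_ι := QuadAlg.adjoin_range_ι _
  adjoin_range_union := by
    rw [← top_le_iff, ← QuadAlg.adjoin_range_ι, Algebra.adjoin_le_iff, Set.range_subset_iff]
    intro ξ
    rw [← dualMap_proj_add_sum_extraForm e ξ, map_add, map_sum]
    refine add_mem (Algebra.subset_adjoin (.inl ⟨ξ ∘ₗ incl e, dualAlgHom_ι ..⟩))
      (sum_mem fun j _ => ?_)
    rw [map_smul]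
    exact Subalgebra.smul_mem _ (Algebra.subset_adjoin (.inr ⟨j, rfl⟩)) _
  map_ι_mul f l := by
    have := h.mulTensor_ι_eq_zero ((dualOreRelations_le.1 le_rfl).2.1 l f)
    simp only [dualCommRelation, map_add, map_sum, mulTensor_tmul] at this
    simp only [dualAlgHom_ι]
    exact eq_neg_of_add_eq_zero_left this
  mul_eq_smul l m := by
    have := h.mulTensor_ι_eq_zero ((dualOreRelations_le.1 le_rfl).2.2 l m)
    simp only [dualVarRelation, map_sub, map_smul, mulTensor_tmul, sub_eq_zero] at this
    exact this
  apply_one_one := h.apply_one_one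

/-- The representation of `T(W*) / ⟨S^⊥⟩` on the free right module with basis
`1, y_0*, y_1*, y_1* y_0*` over `T(V*) / ⟨R^⊥⟩`. -/
noncomputable def representation :
    QuadAlg (perp S) →ₐ[k] Matrix (Fin 4) (Fin 4) (QuadAlg (perp R)) :=
  QuadAlg.lift (perp S) (dualAction e s ρ (QuadAlg.ι (perp R)))
    (h.mulTensor_dualAction (QuadAlg.mulTensor_ι _))

theorem representation_ι (ξ : Module.Dual k W) : h.representation (QuadAlg.ι (perp S) ξ) =
    dualAction e s ρ (QuadAlg.ι (perp R)) ξ :=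
  QuadAlg.lift_ι _ _ _ ξ

theorem rightComb_injective : Function.Injective (rightComb
    (dualAlgHom R S (proj e) h.map_proj_mem : QuadAlg (perp R) →+* QuadAlg (perp S))
    ![1, dualVar e S 0, dualVar e S 1, dualVar e S 1 * dualVar e S 0]) := by
  refine rightComb_injective_of_matrix (h.representation : _ →+* _) 0 (fun a m => ?_)
    fun j m => ?_
  · refine matrix_apply_eq_ite_of_adjoin (Ψ := h.representation.comp (dualAlgHom R S (proj e) _))
      (QuadAlg.adjoin_range_ι _) ?_ a m
    rintro _ ⟨f, rfl⟩ m
    have := LinearMap.congr_fun (dualAction_comp_dualMap_proj (e := e) (s := s) (ρ := ρ)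
      (QuadAlg.ι (perp R))) f
    rw [AlgHom.comp_apply, dualAlgHom_ι, representation_ι]
    refine (congrFun₂ this m 0).trans ?_
    rw [dualMatrix_apply]
    fin_cases m <;> simp [coeffAction, Module.End.one_eq_id]
  · have hy : ∀ l, h.representation (dualVar e S l) = varAction ρ _ l :=
      fun l => (h.representation_ι _).trans (dualAction_extraForm _ l)
    fin_cases j <;> fin_cases m <;>
      simp [hy, varAction, h.apply_one_zero, Matrix.mul_apply, Fin.sum_univ_four]

end Duality

end IsQuadraticOre

section FiniteDimensional

variable {k : Type*} [Field k] {V W : Type*} [AddCommGroup V] [Module k V] [AddCommGroup W]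
  [Module k W] {R : Submodule k (V ⊗[k] V)}

theorem leftInverse_dualAlgHom {S : Submodule k (W ⊗[k] W)} {π : W →ₗ[k] V} {ε : V →ₗ[k] W}
    (hπ : ∀ x ∈ S, TensorProduct.map π π x ∈ R) (hε : ∀ r ∈ R, TensorProduct.map ε ε r ∈ S)
    (h : π ∘ₗ ε = .id) : Function.LeftInverse (dualAlgHom S R ε hε) (dualAlgHom R S π hπ) := by
  refine AlgHom.congr_fun (φ₁ := (dualAlgHom S R ε hε).comp (dualAlgHom R S π hπ))
    (φ₂ := .id k _) (AlgHom.ext_of_adjoin_eq_top (QuadAlg.adjoin_range_ι _) ?_)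
  rintro _ ⟨f, rfl⟩
  simp [dualAlgHom_ι, LinearMap.comp_assoc, h]

theorem dualAlgHom_bijective [FiniteDimensional k V] (π : V ≃ₗ[k] V)
    (hπ : ∀ r ∈ R, TensorProduct.map π.toLinearMap π.toLinearMap r ∈ R) :
    Function.Bijective (dualAlgHom R R π.toLinearMap hπ) := by
  have hmap : R.map (TensorProduct.congr π π).toLinearMap = R :=
    Submodule.eq_of_le_of_finrank_eq (Submodule.map_le_iff_le_comap.2 hπ)
      (LinearEquiv.finrank_map_eq _ R)
  have hsymm : ∀ r ∈ R, TensorProduct.map π.symm.toLinearMap π.symm.toLinearMap r ∈ R :=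
    fun r hr => by
      rw [← hmap] at hr
      obtain ⟨r, hr, rfl⟩ := hr
      rw [TensorProduct.toLinearMap_congr, ← LinearMap.comp_apply, ← TensorProduct.map_comp]
      simpa using hr
  exact ⟨(leftInverse_dualAlgHom hπ hsymm (by simp)).injective,
    (leftInverse_dualAlgHom hsymm hπ (by simp)).surjective⟩

namespace IsQuadraticOre

open scoped Matrix

variable {e : (V × k × k) ≃ₗ[k] W} {S : Submodule k (W ⊗[k] W)}
  {s : Matrix (Fin 2) (Fin 2) (Module.End k V)} {ρ : Matrix (Fin 2) (Fin 2) k}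
  (h : IsQuadraticOre e R S s ρ)

include h

theorem isUnit_oreDet [FiniteDimensional k V] (hρ : ρ 0 1 ≠ 0)
    {t : Matrix (Fin 2) (Fin 2) (Module.End k V)} (ht : t * sᵀ = 1) : IsUnit (oreDet ρ s) := by
  let P := ρ.map (algebraMap k (Module.End k V))
  let Q := (ρ⁻¹).map (algebraMap k (Module.End k V))
  have hdet : IsUnit ρ.det := by simpa [Matrix.det_fin_two, h.apply_one_zero, h.apply_one_one]
  have hQP : Q * P = 1 := by
    rw [← Matrix.map_mul, ρ.nonsing_inv_mul hdet, Matrix.map_one _ (map_zero _) (map_one _)]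
  have hs : s = Q * t * P * Matrix.diagonal fun _ => oreDet ρ s :=
    calc s = Q * (t * sᵀ) * (P * s) := by rw [ht, mul_one, ← mul_assoc, hQP, one_mul]
      _ = Q * t * (sᵀ * P * s) := by simp only [mul_assoc]
      _ = _ := by rw [h.transpose_mul_mul]; simp only [P, mul_assoc]
  have hinv : (∑ l, t 0 l * (Q * t * P) 0 l) * oreDet ρ s = 1 := by
    calc _ = ∑ l, t 0 l * s 0 l := by
          conv_rhs => rw [hs]
          simp [Matrix.mul_diagonal, Finset.sum_mul, mul_assoc, -Fin.sum_univ_two]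
      _ = 1 := congrFun₂ ht 0 0
  exact .of_mul_eq_one_right _ hinv

theorem dualAlgHom_oreDet_bijective [FiniteDimensional k V] (hρ : ρ 0 1 ≠ 0)
    {t : Matrix (Fin 2) (Fin 2) (Module.End k V)} (ht : t * sᵀ = 1) :
    Function.Bijective (dualAlgHom R R (oreDet ρ s) h.map_oreDet_mem) :=
  dualAlgHom_bijective (.ofBijective _ ((Module.End.isUnit_iff _).1 (h.isUnit_oreDet hρ ht)))
    h.map_oreDet_mem

theorem dualAlgHom_injective : Function.Injective (dualAlgHom R S (proj e) h.map_proj_mem) :=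
  h.isDualOre.injective h.rightComb_injective

theorem isRightBasis (hρ : ρ 0 1 ≠ 0) : IsRightBasis
    (dualAlgHom R S (proj e) h.map_proj_mem : QuadAlg (perp R) →+* QuadAlg (perp S))
    ![1, dualVar e S 0, dualVar e S 1, dualVar e S 0 * dualVar e S 1] :=
  h.isDualOre.isRightBasis h.rightComb_injective hρ

theorem isLeftBasis [FiniteDimensional k V] (hρ : ρ 0 1 ≠ 0)
    {t : Matrix (Fin 2) (Fin 2) (Module.End k V)} (ht : t * sᵀ = 1) : IsLeftBasis
    (dualAlgHom R S (proj e) h.map_proj_mem : QuadAlg (perp R) →+* QuadAlg (perp S))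
    ![1, dualVar e S 0, dualVar e S 1, dualVar e S 0 * dualVar e S 1] :=
  h.isDualOre.isLeftBasis h.rightComb_injective (dualAlgHom_ι R R _ h.map_oreDet_mem)
    (h.dualAlgHom_oreDet_bijective hρ ht) ht hρ

end IsQuadraticOre

end FiniteDimensional

/-- The coefficient matrix of the relation `y₂ y₁ - p y₁ y₂ - q y₁ ^ 2 = 0`. -/
def varCoeff {k : Type*} [Ring k] (p q : k) : Matrix (Fin 2) (Fin 2) k := !![-q, -p; 1, 0]

namespace IsTrimmedRightDoubleOre

variable {k : Type u} [Field k] {A : Type v} [Ring A] [Algebra k A]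
  {B : Type w} [Ring B] [Algebra k B] {𝒜 : ℕ → Submodule k A} {ℬ : ℕ → Submodule k B}
  {i : A →ₐ[k] B} {y₁ y₂ : B} {p q : k} {σ : A → Matrix (Fin 2) (Fin 2) A}
  (hB : IsTrimmedRightDoubleOre 𝒜 ℬ i y₁ y₂ p q σ)

include hB

theorem var_mul_map (j : Fin 2) (a : A) :
    ![y₁, y₂] j * i a = ∑ l, i (σ a j l) * ![y₁, y₂] l := by
  fin_cases j
  · simpa using hB.rightDoubleOre.comm₁ a
  · simpa using hB.rightDoubleOre.comm₂ a

theorem y₂_mul_y₁ : y₂ * y₁ = p • (y₁ * y₂) + q • (y₁ * y₁) := by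
  simpa [pow_two] using hB.rightDoubleOre.relation

theorem sum_varCoeff_smul_mul :
    ∑ j, ∑ n, varCoeff p q j n • (![y₁, y₂] j * ![y₁, y₂] n) = 0 := by
  simp [varCoeff, hB.y₂_mul_y₁]

theorem eq_zero_of_normal_form {a b₁ b₂ c₁ c₂ c₃ : A} (h : i a + i b₁ * y₁ + i b₂ * y₂ +
    i c₁ * (y₁ * y₁) + i c₂ * (y₁ * y₂) + i c₃ * (y₂ * y₂) = 0) :
    a = 0 ∧ b₁ = 0 ∧ b₂ = 0 ∧ c₁ = 0 ∧ c₂ = 0 ∧ c₃ = 0 := by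
  obtain ⟨P, -, hP⟩ := hB.exists_coeff
  have hsum : Finsupp.single (0, 0) a + Finsupp.single (1, 0) b₁ + Finsupp.single (0, 1) b₂ +
      Finsupp.single (2, 0) c₁ + Finsupp.single (1, 1) c₂ + Finsupp.single (0, 2) c₃ = 0 := by
    simp only [← hP, ← map_add, ← map_zero P, pow_zero, pow_one, pow_two, mul_one, one_mul, h]
  have hcoeff := DFunLike.congr_fun hsum
  exact ⟨by simpa using hcoeff (0, 0), by simpa using hcoeff (1, 0), by simpa using hcoeff (0, 1),
    by simpa using hcoeff (2, 0), by simpa using hcoeff (1, 1), by simpa using hcoeff (0, 2)⟩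

theorem coeff_eq_of_sum_eq_zero {a : A} {b : Fin 2 → A} {X : Matrix (Fin 2) (Fin 2) A}
    (h : i a + ∑ l, i (b l) * ![y₁, y₂] l +
      ∑ l, ∑ m, i (X l m) * (![y₁, y₂] l * ![y₁, y₂] m) = 0) :
    a = 0 ∧ b = 0 ∧ ∀ l m, X l m = varCoeff p q l m • X 1 0 := by
  simp only [Fin.sum_univ_two, Matrix.cons_val_zero, Matrix.cons_val_one] at h
  obtain ⟨ha, hb₀, hb₁, h₀₀, h₀₁, h₁₁⟩ := hB.eq_zero_of_normal_form (a := a) (b₁ := b 0)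
    (b₂ := b 1) (c₁ := X 0 0 + q • X 1 0) (c₂ := X 0 1 + p • X 1 0) (c₃ := X 1 1) <| by
      rw [← h, hB.y₂_mul_y₁]
      simp only [map_add, map_smul, add_mul, mul_add, smul_mul_assoc, mul_smul_comm]
      abel
  refine ⟨ha, funext fun l => ?_, fun l m => ?_⟩
  · fin_cases l <;> assumption
  · rw [← eq_neg_iff_add_eq_zero] at h₀₀ h₀₁
    fin_cases l <;> fin_cases m <;> simp [varCoeff, *]

theorem coeff_eq_of_sum_eq {b c : Fin 2 → A}
    (h : ∑ l, i (b l) * ![y₁, y₂] l = ∑ l, i (c l) * ![y₁, y₂] l) : b = c := by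
  refine sub_eq_zero.1 (hB.coeff_eq_of_sum_eq_zero (a := 0) (b := b - c) (X := 0) ?_).2.1
  simp only [Pi.sub_apply, map_sub, sub_mul, Finset.sum_sub_distrib, h]
  simp

theorem apply_eq_of_var_mul_map {a : A} {M : Matrix (Fin 2) (Fin 2) A}
    (h : ∀ j, ![y₁, y₂] j * i a = ∑ l, i (M j l) * ![y₁, y₂] l) : σ a = M :=
  funext fun j => hB.coeff_eq_of_sum_eq <| (hB.var_mul_map j a).symm.trans (h j)

/-- The map `σ : A → M_{2 × 2}(A)` as an algebra homomorphism. -/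
def sigmaHom : A →ₐ[k] Matrix (Fin 2) (Fin 2) A :=
  AlgHom.ofLinearMap
    { toFun := σ
      map_add' := fun a b => hB.apply_eq_of_var_mul_map fun j => by
        simp only [map_add, mul_add, hB.var_mul_map, Matrix.add_apply, add_mul,
          Finset.sum_add_distrib]
      map_smul' := fun c a => hB.apply_eq_of_var_mul_map fun j => by
        simp only [map_smul, mul_smul_comm, hB.var_mul_map, Matrix.smul_apply, smul_mul_assoc,
          Finset.smul_sum, RingHom.id_apply] }
    (hB.apply_eq_of_var_mul_map fun j => by simp [Matrix.one_apply, -Fin.sum_univ_two])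
    fun a b => hB.apply_eq_of_var_mul_map fun j => by
      simp only [LinearMap.coe_mk, AddHom.coe_mk, Matrix.mul_apply, map_sum, map_mul,
        Finset.sum_mul, mul_assoc]
      rw [← mul_assoc, hB.var_mul_map, Finset.sum_mul]
      simp only [mul_assoc, hB.var_mul_map, Finset.mul_sum]
      exact Finset.sum_comm

theorem sum_varCoeff_smul_sigma_sigma (a : A) (l m : Fin 2) :
    ∑ j, ∑ n, varCoeff p q j n • σ (σ a n m) j l =
      varCoeff p q l m • ∑ j, ∑ n, varCoeff p q j n • σ (σ a n 0) j 1 := by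
  refine (hB.coeff_eq_of_sum_eq_zero (a := 0) (b := 0)
    (X := .of fun l m => ∑ j, ∑ n, varCoeff p q j n • σ (σ a n m) j l) ?_).2.2 l m
  have hmul : ∀ j n, ![y₁, y₂] j * ![y₁, y₂] n * i a =
      ∑ l, ∑ m, i (σ (σ a n m) j l) * (![y₁, y₂] l * ![y₁, y₂] m) := fun j n => by
    rw [mul_assoc, hB.var_mul_map, Finset.mul_sum, Finset.sum_comm]
    simp only [← mul_assoc, hB.var_mul_map, Finset.sum_mul]
  have h := congrArg (· * i a) hB.sum_varCoeff_smul_mul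
  simp only [Finset.sum_mul, smul_mul_assoc, hmul, zero_mul] at h
  refine Eq.trans ?_ h
  simp only [Pi.zero_apply, map_zero, zero_mul, Finset.sum_const_zero, zero_add, Matrix.of_apply,
    map_add, map_smul, add_mul, smul_add, smul_mul_assoc, Fin.sum_univ_two]
  abel

end IsTrimmedRightDoubleOre

namespace IsTrimmedRightDoubleOre

section Graded

open scoped Matrix

variable {k : Type u} [Field k] {A : Type v} [Ring A] [Algebra k A]
  {B : Type w} [Ring B] [Algebra k B] {𝒜 : ℕ → Submodule k A} {ℬ : ℕ → Submodule k B}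
  {i : A →ₐ[k] B} {y₁ y₂ : B} {p q : k} {σ : A → Matrix (Fin 2) (Fin 2) A}
  (hB : IsTrimmedRightDoubleOre 𝒜 ℬ i y₁ y₂ p q σ)

include hB

theorem var_mem (j : Fin 2) : ![y₁, y₂] j ∈ ℬ 1 := by
  fin_cases j
  · exact hB.y₁_mem
  · exact hB.y₂_mem

variable [GradedAlgebra 𝒜] [GradedAlgebra ℬ]

theorem decompose_map (a : A) (n : ℕ) :
    (DirectSum.decompose ℬ (i a) n : B) = i (DirectSum.decompose 𝒜 a n) := by
  induction a using DirectSum.Decomposition.inductionOn 𝒜 with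
  | zero => simp
  | add a b ha hb => simp [DirectSum.decompose_add, ha, hb]
  | @homogeneous d a =>
    have ha : i a ∈ ℬ d := hB.map_mem d a a.2
    by_cases h : d = n
    · subst h
      rw [DirectSum.decompose_of_mem_same _ ha, DirectSum.decompose_of_mem_same _ a.2]
    · rw [DirectSum.decompose_of_mem_ne _ ha h, DirectSum.decompose_of_mem_ne _ a.2 h, map_zero]

theorem decompose_sigma (a : A) (n : ℕ) (j l : Fin 2) :
    (DirectSum.decompose 𝒜 (σ a j l) n : A) = σ (DirectSum.decompose 𝒜 a n) j l := by
  have hdecompose (x : A) (l : Fin 2) : i (DirectSum.decompose 𝒜 x n) * ![y₁, y₂] l =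
      GradedRing.proj ℬ (n + 1) (i x * ![y₁, y₂] l) := by
    rw [GradedRing.proj_apply, DirectSum.coe_decompose_mul_add_of_right_mem ℬ (hB.var_mem l),
      hB.decompose_map]
  refine congrFun (hB.coeff_eq_of_sum_eq (b := fun l => DirectSum.decompose 𝒜 (σ a j l) n) ?_) l
  calc ∑ l, i (DirectSum.decompose 𝒜 (σ a j l) n) * ![y₁, y₂] l
    _ = GradedRing.proj ℬ (n + 1) (![y₁, y₂] j * i a) := by
      simp only [hdecompose, hB.var_mul_map, map_sum]
    _ = ![y₁, y₂] j * i (DirectSum.decompose 𝒜 a n) := by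
      rw [GradedRing.proj_apply, add_comm n,
        DirectSum.coe_decompose_mul_add_of_left_mem ℬ (hB.var_mem j), hB.decompose_map]
    _ = ∑ l, i (σ (DirectSum.decompose 𝒜 a n) j l) * ![y₁, y₂] l := hB.var_mul_map j _

theorem sigma_mem {n : ℕ} {a : A} (ha : a ∈ 𝒜 n) (j l : Fin 2) : σ a j l ∈ 𝒜 n := by
  have h := hB.decompose_sigma a n j l
  rw [DirectSum.decompose_of_mem_same _ ha] at h
  exact h ▸ SetLike.coe_mem _

/-- The matrix of the maps `σ_jl` restricted to `A₁`. -/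
def sigmaOne : Matrix (Fin 2) (Fin 2) (Module.End k (𝒜 1)) := .of fun j l =>
  (Matrix.entryLinearMap k A j l ∘ₗ hB.sigmaHom.toLinearMap).restrict fun _ ha =>
    hB.sigma_mem ha j l

theorem coe_sigmaOne (j l : Fin 2) (a : 𝒜 1) : (hB.sigmaOne j l a : A) = σ a j l := rfl

theorem mulTensor_sum_map_sigmaOne (r : 𝒜 1 ⊗[k] 𝒜 1) (j l : Fin 2) :
    mulTensor (𝒜 1).subtype (∑ m, TensorProduct.map (hB.sigmaOne j m) (hB.sigmaOne m l) r) =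
      hB.sigmaHom (mulTensor (𝒜 1).subtype r) j l := by
  induction r with
  | zero => simp
  | add x y hx hy => simp only [map_add, Finset.sum_add_distrib, hx, hy, Matrix.add_apply]
  | tmul a b =>
    rw [mulTensor_tmul, map_mul, Matrix.mul_apply, map_sum]
    simp only [TensorProduct.map_tmul, mulTensor_tmul]
    rfl

theorem sum_map_sigmaOne_mem {r : 𝒜 1 ⊗[k] 𝒜 1} (hr : r ∈ relations 𝒜) (j l : Fin 2) :
    ∑ m, TensorProduct.map (hB.sigmaOne j m) (hB.sigmaOne m l) r ∈ relations 𝒜 := by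
  rw [relations, LinearMap.mem_ker] at hr ⊢
  rw [mulTensor_sum_map_sigmaOne, hr, map_zero, Matrix.zero_apply]

theorem transpose_mul_varCoeff_mul_sigmaOne :
    hB.sigmaOneᵀ * (varCoeff p q).map (algebraMap k _) * hB.sigmaOne =
      (varCoeff p q).map (algebraMap k _) *
        Matrix.diagonal fun _ => oreDet (varCoeff p q) hB.sigmaOne := by
  refine transpose_mul_mul_eq_iff.2 fun l m => LinearMap.ext fun a => Subtype.ext ?_
  simpa [oreDet_eq_sum, coe_sigmaOne] using hB.sum_varCoeff_smul_sigma_sigma a l m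

variable (hA : IsQuadratic 𝒜)

theorem coe_incl_degreeOneEquiv (a : 𝒜 1) : (incl (hB.degreeOneEquiv hA) a : B) = i a := by
  change i a + (0 : k) • y₁ + (0 : k) • y₂ = i a
  simp

theorem coe_extraVar_degreeOneEquiv (j : Fin 2) :
    ((extraVar (hB.degreeOneEquiv hA) j : ℬ 1) : B) = ![y₁, y₂] j := by
  fin_cases j
  · change i (0 : 𝒜 1) + (1 : k) • y₁ + (0 : k) • y₂ = y₁
    simp
  · change i (0 : 𝒜 1) + (0 : k) • y₁ + (1 : k) • y₂ = y₂
    simp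

theorem mulTensor_map_incl (r : 𝒜 1 ⊗[k] 𝒜 1) :
    mulTensor (ℬ 1).subtype (TensorProduct.map (incl (hB.degreeOneEquiv hA))
      (incl (hB.degreeOneEquiv hA)) r) = i (mulTensor (𝒜 1).subtype r) := by
  induction r with
  | zero => simp
  | add x y hx hy => simp only [map_add, hx, hy]
  | tmul a b => simp [mulTensor_tmul, coe_incl_degreeOneEquiv]

theorem oreRelations_le_relations :
    oreRelations (hB.degreeOneEquiv hA) (relations 𝒜) hB.sigmaOne (varCoeff p q) ≤
      relations ℬ := by
  simp only [oreRelations_le, relations, LinearMap.mem_ker]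
  refine ⟨fun r hr => ?_, fun j a => ?_, ?_⟩
  · rw [hB.mulTensor_map_incl hA, hr, map_zero]
  · simp only [commRelation, map_sub, map_sum, mulTensor_tmul, Submodule.subtype_apply,
      coe_incl_degreeOneEquiv, coe_extraVar_degreeOneEquiv, coe_sigmaOne, hB.var_mul_map, sub_self]
  · simp only [varRelation, map_sum, map_smul, mulTensor_tmul, Submodule.subtype_apply,
      coe_extraVar_degreeOneEquiv, hB.sum_varCoeff_smul_mul]

theorem mulTensor_subtype_normal_form (r : 𝒜 1 ⊗[k] 𝒜 1) (a b : Fin 2 → 𝒜 1)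
    (c : Matrix (Fin 2) (Fin 2) k) :
    mulTensor (ℬ 1).subtype
      (TensorProduct.map (incl (hB.degreeOneEquiv hA)) (incl (hB.degreeOneEquiv hA)) r
        + ∑ j, incl (hB.degreeOneEquiv hA) (a j) ⊗ₜ extraVar (hB.degreeOneEquiv hA) j
        + ∑ j, extraVar (hB.degreeOneEquiv hA) j ⊗ₜ incl (hB.degreeOneEquiv hA) (b j)
        + ∑ j, ∑ l, c j l •
          extraVar (hB.degreeOneEquiv hA) j ⊗ₜ extraVar (hB.degreeOneEquiv hA) l) =
    i (mulTensor (𝒜 1).subtype r) + ∑ l, i (a l + ∑ j, σ (b j) j l) * ![y₁, y₂] l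
      + ∑ l, ∑ m, i (algebraMap k A (c l m)) * (![y₁, y₂] l * ![y₁, y₂] m) := by
  simp only [map_add, map_sum, map_smul, mulTensor_tmul, hB.mulTensor_map_incl hA,
    Submodule.subtype_apply, coe_incl_degreeOneEquiv, coe_extraVar_degreeOneEquiv,
    hB.var_mul_map, AlgHom.commutes, ← Algebra.smul_def, add_mul, Finset.sum_mul,
    Finset.sum_add_distrib]
  rw [Finset.sum_comm (f := fun j l => i (σ (b l) l j) * _), add_assoc (i _)]

theorem relations_eq : relations ℬ =
    oreRelations (hB.degreeOneEquiv hA) (relations 𝒜) hB.sigmaOne (varCoeff p q) := by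
  refine le_antisymm (fun x hx => ?_) (hB.oreRelations_le_relations hA)
  have := hA.nontrivial
  let e := hB.degreeOneEquiv hA
  obtain ⟨r, a, b, c, rfl⟩ := exists_tensor_decomposition (f := incl e) (Y := extraVar e)
    (fun x => ⟨_, _, incl_proj_add_sum_extraVar e x⟩) x
  rw [relations, LinearMap.mem_ker, hB.mulTensor_subtype_normal_form hA] at hx
  obtain ⟨hr, ha, hc⟩ := hB.coeff_eq_of_sum_eq_zero (X := c.map (algebraMap k A)) hx
  have hc' : c = c 1 0 • varCoeff p q := by
    ext l m
    refine (algebraMap k A).injective ((hc l m).trans ?_)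
    simp [Algebra.smul_def, mul_comm (c 1 0)]
  have ha' : ∀ l, a l = -∑ j, hB.sigmaOne j l (b j) := fun l => by
    refine eq_neg_of_add_eq_zero_left (Subtype.ext ?_)
    simpa [coe_sigmaOne] using congrFun ha l
  rw [funext ha', hc']
  exact tensor_mem_oreRelations hr b (c 1 0)

theorem isQuadraticOre : IsQuadraticOre (hB.degreeOneEquiv hA) (relations 𝒜) (relations ℬ)
    hB.sigmaOne (varCoeff p q) where
  relations_eq := hB.relations_eq hA
  apply_one_zero := rfl
  apply_one_one := rfl
  sum_map_mem _ hr := hB.sum_map_sigmaOne_mem hr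
  transpose_mul_mul := hB.transpose_mul_varCoeff_mul_sigmaOne

end Graded

end IsTrimmedRightDoubleOre

theorem exists_mul_eq_one_of_exists_mulVec {k V n : Type*} [Field k] [AddCommGroup V] [Module k V]
    [FiniteDimensional k V] [Fintype n] [DecidableEq n] {s : Matrix n n (Module.End k V)}
    (h : ∀ l a, ∃ u : n → V, ∀ m, ∑ j, s m j (u j) = Pi.single (M := fun _ => V) l a m) :
    ∃ t, t * s = 1 := by
  let φ := endVecRingEquivMatrixEnd n k V
  have hsurj : Function.Surjective (φ.symm s) := by
    choose u hu using h
    refine fun v => ⟨∑ l, u l (v l), funext fun m => ?_⟩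
    have hφ : φ.symm s (∑ l, u l (v l)) m = ∑ j, s m j ((∑ l, u l (v l)) j) := rfl
    simp only [hφ, Finset.sum_apply, map_sum]
    rw [Finset.sum_comm]
    simp [hu, Pi.single_apply]
  have hunit : IsUnit s := by
    simpa using ((Module.End.isUnit_iff _).2
      ⟨LinearMap.injective_iff_surjective.2 hsurj, hsurj⟩).map φ
  exact hunit.exists_left_inv

namespace IsTrimmedRightDoubleOre

section DoubleOre

open scoped Matrix

variable {k : Type u} [Field k] {A : Type v} [Ring A] [Algebra k A]
  {B : Type w} [Ring B] [Algebra k B] {𝒜 : ℕ → Submodule k A} {ℬ : ℕ → Submodule k B}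
  {i : A →ₐ[k] B} {y₁ y₂ : B} {p q : k} {σ : A → Matrix (Fin 2) (Fin 2) A}
  (hB : IsTrimmedRightDoubleOre 𝒜 ℬ i y₁ y₂ p q σ) (hL : IsLeftDoubleOre i y₁ y₂)

include hB hL

theorem ne_zero_of_isLeftDoubleOre [Nontrivial A] : p ≠ 0 := by
  rintro rfl
  obtain ⟨p', q', τ₀, τ₁, τ₂, h⟩ := hL.relation
  have hcoeff := (hB.coeff_eq_of_sum_eq_zero (a := -τ₀) (b := -![τ₁, τ₂])
    (X := !![algebraMap k A (-q'), 1; algebraMap k A (-p'), 0]) ?_).2.2 0 1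
  · simp [varCoeff] at hcoeff
  · simp [h, ← Algebra.smul_def, pow_two]
    abel

theorem exists_sum_sigma_eq_single (l : Fin 2) (a : A) :
    ∃ u : Fin 2 → A, ∀ m, ∑ j, σ (u j) j m = Pi.single (M := fun _ => A) l a m := by
  obtain ⟨a₁, a₂, a₀, h⟩ : ∃ a₁ a₂ a₀, i a * ![y₁, y₂] l = y₁ * i a₁ + y₂ * i a₂ + i a₀ := by
    fin_cases l
    · exact hL.comm₁ a
    · exact hL.comm₂ a
  refine ⟨![a₁, a₂], fun m => (sub_eq_zero.1 <| congrFun (hB.coeff_eq_of_sum_eq_zero (a := -a₀)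
    (b := fun m => Pi.single (M := fun _ => A) l a m - ∑ j, σ (![a₁, a₂] j) j m)
    (X := 0) ?_).2.1 m).symm⟩
  have hsingle : ∑ m, i (Pi.single (M := fun _ => A) l a m) * ![y₁, y₂] m = i a * ![y₁, y₂] l := by
    simp [Pi.single_apply, apply_ite i, -Fin.sum_univ_two]
  have hsigma : ∑ m, i (∑ j, σ (![a₁, a₂] j) j m) * ![y₁, y₂] m = y₁ * i a₁ + y₂ * i a₂ := by
    simp only [map_sum, Finset.sum_mul]
    rw [Finset.sum_comm]
    simp only [← hB.var_mul_map]
    simp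
  simp only [map_sub, sub_mul, Finset.sum_sub_distrib, hsingle, hsigma, h]
  simp

variable [GradedAlgebra 𝒜] [GradedAlgebra ℬ]

theorem exists_mul_transpose_sigmaOne_eq_one [FiniteDimensional k (𝒜 1)] :
    ∃ t, t * hB.sigmaOneᵀ = 1 := by
  refine exists_mul_eq_one_of_exists_mulVec fun l a => ?_
  obtain ⟨u, hu⟩ := hB.exists_sum_sigma_eq_single hL l a
  refine ⟨fun j => DirectSum.decompose 𝒜 (u j) 1, fun m => Subtype.ext ?_⟩
  have h := congrArg (GradedRing.proj 𝒜 1) (hu m)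
  simp only [map_sum, GradedRing.proj_apply, hB.decompose_sigma] at h
  rw [AddSubmonoidClass.coe_finsetSum]
  refine h.trans ?_
  rcases eq_or_ne m l with rfl | hml
  · simp
  · simp [hml]

end DoubleOre

end IsTrimmedRightDoubleOre

end KoszulOre

open KoszulOre in
theorem proposition2_general {k : Type u} [Field k]
    {A : Type v} [Ring A] [Algebra k A] (𝒜 : ℕ → Submodule k A) [GradedAlgebra 𝒜]
    {B : Type w} [Ring B] [Algebra k B] (ℬ : ℕ → Submodule k B) [GradedAlgebra ℬ]
    (i : A →ₐ[k] B) (y₁ y₂ : B) (p q : k) (σ : A → Matrix (Fin 2) (Fin 2) A)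
    (hA : IsQuadratic 𝒜) (hB : IsTrimmedRightDoubleOre 𝒜 ℬ i y₁ y₂ p q σ) :
    Function.Injective (hB.dualMap hA) ∧
    (p ≠ 0 → IsRightBasis (hB.dualMap hA : KoszulDual 𝒜 →+* KoszulDual ℬ)
      ![1, hB.y₁Dual hA, hB.y₂Dual hA, hB.y₁Dual hA * hB.y₂Dual hA]) ∧
    (IsLeftDoubleOre i y₁ y₂ →
      IsRightBasis (hB.dualMap hA : KoszulDual 𝒜 →+* KoszulDual ℬ)
        ![1, hB.y₁Dual hA, hB.y₂Dual hA, hB.y₁Dual hA * hB.y₂Dual hA] ∧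
      IsLeftBasis (hB.dualMap hA : KoszulDual 𝒜 →+* KoszulDual ℬ)
        ![1, hB.y₁Dual hA, hB.y₂Dual hA, hB.y₁Dual hA * hB.y₂Dual hA]) := by
  have := hA.nontrivial
  have := hA.finite
  have hOre := hB.isQuadraticOre hA
  have hρ : p ≠ 0 → varCoeff p q 0 1 ≠ 0 := neg_ne_zero.2
  refine ⟨hOre.dualAlgHom_injective, fun hp => hOre.isRightBasis (hρ hp), fun hL => ?_⟩
  have hp := hB.ne_zero_of_isLeftDoubleOre hL
  obtain ⟨t, ht⟩ := hB.exists_mul_transpose_sigmaOne_eq_one hL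
  exact ⟨hOre.isRightBasis (hρ hp), hOre.isLeftBasis (hρ hp) ht⟩

open KoszulOre in
theorem proposition2 {k : Type u} [Field k]
    {A : Type v} [Ring A] [Algebra k A] (𝒜 : ℕ → Submodule k A) [GradedAlgebra 𝒜]
    {B : Type w} [Ring B] [Algebra k B] (ℬ : ℕ → Submodule k B) [GradedAlgebra ℬ]
    (i : A →ₐ[k] B) (y₁ y₂ : B) (p q : k) (σ : A → Matrix (Fin 2) (Fin 2) A)
    (hA : IsKoszul 𝒜) (hB : IsTrimmedRightDoubleOre 𝒜 ℬ i y₁ y₂ p q σ) :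
    Function.Injective (hB.dualMap hA.isQuadratic) ∧
    (p ≠ 0 →
      IsRightBasis (hB.dualMap hA.isQuadratic : KoszulDual 𝒜 →+* KoszulDual ℬ)
        ![1, hB.y₁Dual hA.isQuadratic, hB.y₂Dual hA.isQuadratic,
          hB.y₁Dual hA.isQuadratic * hB.y₂Dual hA.isQuadratic]) ∧
    (IsLeftDoubleOre i y₁ y₂ →
      IsRightBasis (hB.dualMap hA.isQuadratic : KoszulDual 𝒜 →+* KoszulDual ℬ)
        ![1, hB.y₁Dual hA.isQuadratic, hB.y₂Dual hA.isQuadratic,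
          hB.y₁Dual hA.isQuadratic * hB.y₂Dual hA.isQuadratic] ∧
      IsLeftBasis (hB.dualMap hA.isQuadratic : KoszulDual 𝒜 →+* KoszulDual ℬ)
        ![1, hB.y₁Dual hA.isQuadratic, hB.y₂Dual hA.isQuadratic,
          hB.y₁Dual hA.isQuadratic * hB.y₂Dual hA.isQuadratic]) :=
  proposition2_general 𝒜 ℬ i y₁ y₂ p q σ hA.isQuadratic hB
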